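/- For a finite field $\mathbb{F}_q$ with $q$ elements and a tuple $\mathbf l=(l_1,\ldots,l_s)$ of nonnegative integers with sum $N=l_1+\cdots+l_s$, let $M^{\mathbf l}(q)$ be the set of all block upper triangular $N\times N$ matrices over $\mathbb{F}_q$ with diagonal blocks of sizes $l_1,\ldots,l_s$ (in this order). Let $P^{\mathbf l}(q)$ be the group of all invertible matrices in $M^{\mathbf l}(q)$, and $N^{\mathbf l}(q)$ the set of all nilpotent matrices in $M^{\mathbf l}(q)$. Let $\rho_{\mathbf l}(q)$ be the number of orbits of $P^{\mathbf l}(q)$ acting on $N^{\mathbf l}(q)$ by conjugation, and write $\rho_{k,\mathbf l}(q)=\rho_{(k,l_1,\ldots,l_s)}(q)$. Theorem. Let $k,m$ be nonnegative integers and let $n=m(m-1)/2$. There exist integers $a_{k0},\ldots,a_{kn}$, depending only on $k$ and $m$, such that, for all tuples $\mathbf l=(l_1,\ldots,l_s)$ of nonnegative integers with $l_1+\cdots+l_s=m$ and all prime powers $q$, $$\rho_{k,\mathbf l}(q)=\sum_{j=0}^n a_{kj}\,\rho_{j,\mathbf l}(q).$$ -/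

import Mathlib

/-- Row and column indices of block matrices with block sizes `l 0, …, l (s-1)`: the pair
`⟨i, a⟩` is the `a`-th index in the `i`-th block. -/
abbrev BlockIndex {s : ℕ} (l : Fin s → ℕ) : Type := Σ i : Fin s, Fin (l i)

/-- The number `γ(G, X)` of orbits of a group `G` acting on a finite set `X`. -/
noncomputable def orbitCount (G X : Type*) [Group G] [MulAction G X] : ℕ :=
  Nat.card (MulAction.orbitRel.Quotient G X)

/-- `M^l`: the algebra of block upper triangular matrices over `F` with diagonal blocks of sizes
`l 0, …, l (s-1)`; all entries whose row block comes after the column block vanish. -/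
def blockTriangularMatrices (F : Type*) [Field F] {s : ℕ} (l : Fin s → ℕ) :
    Subalgebra F (Matrix (BlockIndex l) (BlockIndex l) F) where
  carrier := {X | X.BlockTriangular Sigma.fst}
  mul_mem' hX hY := hX.mul hY
  add_mem' hX hY := hX.add hY
  algebraMap_mem' c := by
    rw [Matrix.algebraMap_eq_diagonal]
    exact Matrix.blockTriangular_diagonal _

/-- `P^l`: the parabolic group of all invertible matrices in `M^l`. -/
def parabolicGroup (F : Type*) [Field F] {s : ℕ} (l : Fin s → ℕ) :
    Subgroup (Matrix.GeneralLinearGroup (BlockIndex l) F) where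
  carrier := {g | (g : Matrix (BlockIndex l) (BlockIndex l) F) ∈ blockTriangularMatrices F l}
  one_mem' := (blockTriangularMatrices F l).one_mem
  mul_mem' hg hh := (blockTriangularMatrices F l).mul_mem hg hh
  inv_mem' {g} hg := by
    have : Invertible (g : Matrix (BlockIndex l) (BlockIndex l) F) := g.invertible
    have h : (g : Matrix (BlockIndex l) (BlockIndex l) F).BlockTriangular Sigma.fst := hg
    have h' := Matrix.blockTriangular_inv_of_blockTriangular h
    rw [← Matrix.coe_units_inv] at h'
    exact h'

/-- `N^l`: the set of all nilpotent matrices in `M^l`. -/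
def nilpotentBlockMatrices (F : Type*) [Field F] {s : ℕ} (l : Fin s → ℕ) :
    Set (Matrix (BlockIndex l) (BlockIndex l) F) :=
  {X | X ∈ blockTriangularMatrices F l ∧ IsNilpotent X}

theorem conj_mem_nilpotentBlockMatrices {F : Type*} [Field F] {s : ℕ} {l : Fin s → ℕ}
    (g : parabolicGroup F l) {X : Matrix (BlockIndex l) (BlockIndex l) F}
    (hX : X ∈ nilpotentBlockMatrices F l) :
    g.1.val * X * g.1⁻¹.val ∈ nilpotentBlockMatrices F l := by
  refine ⟨mul_mem (mul_mem g.2 hX.1) (inv_mem g.2), ?_⟩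
  obtain ⟨n, hn⟩ := hX.2
  exact ⟨n, by rw [Units.conj_pow, hn, mul_zero, zero_mul]⟩

/-- `P^l` acts on `N^l` by conjugation, `g • X = g X g⁻¹`. -/
instance parabolicConjAction (F : Type*) [Field F] {s : ℕ} (l : Fin s → ℕ) :
    MulAction (parabolicGroup F l) (nilpotentBlockMatrices F l) where
  smul g X := ⟨g.1.val * X.1 * g.1⁻¹.val, conj_mem_nilpotentBlockMatrices g X.2⟩
  one_smul X := Subtype.ext (by
    change (1 : Matrix (BlockIndex l) (BlockIndex l) F) * X.1 *
      ((1 : Matrix.GeneralLinearGroup (BlockIndex l) F)⁻¹).val = X.1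
    simp)
  mul_smul g h X := Subtype.ext (by
    change (g.1 * h.1).val * X.1 * ((g.1 * h.1)⁻¹).val =
      g.1.val * (h.1.val * X.1 * h.1⁻¹.val) * g.1⁻¹.val
    rw [mul_inv_rev, Units.val_mul, Units.val_mul]
    simp only [mul_assoc])

/-- `ρ_l(q)` for `q = |F|`: the number of `P^l`-orbits on `N^l`. -/
noncomputable def rho (F : Type*) [Field F] {s : ℕ} (l : Fin s → ℕ) : ℕ :=
  orbitCount (parabolicGroup F l) (nilpotentBlockMatrices F l)

/-! By Burnside, `ρ` times the order of the parabolic group is the number of commuting pairs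
(invertible, nilpotent) of block triangular matrices. A pair for `(k, l)` lies over a pair `(p, Y)`
for `l`; it consists of a pair `(g, a)` on `F^k` and off-diagonal blocks `(u, c)` with `g c + u Y =
a u + c p`. By trace duality (`card_commuting_extensions`) this linear equation has `q^(km)` times
as many solutions as there are maps `F^k → F^m` intertwining `(g, a)` with `(p, Y)`. The powers of
`q` cancel, so `ρ_{k,l} |P^l|` is the sum over `(p, Y)` of the number of triples (`g`, `a`,
intertwiner) divided by `|GL_k|`, the mass (`rho_cons_mul_card`).

Sort the triples by the image `J` of the intertwiner. The same duality, applied to the kernel of a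
surjection onto `J`, shows that surjective triples contribute the mass of `J` in degree `k - dim J`.
Hence the mass series satisfies `Z(W) = ∑ X^(dim J) Z(J)` over the invariant subspaces `J` of `W`.
Moving the term `J = W` to the left and inducting on dimension gives `Z(W) ∏_{j=1}^m (1 - X^j) = C
Q` with `deg Q ≤ m(m-1)/2` (`exists_massSeries_mul_eq`). Here `C = Z(0)` counts nilpotent conjugacy
classes; by Jordan form it does not depend on `q`, and its constant term is 1.

Thus `∑ ρ_{k,l} X^k` times a unit of `ℤ⟦X⟧` depending only on `m` is a polynomial of degree at most
`m(m-1)/2`, so its first `m(m-1)/2 + 1` coefficients determine all others by fixed integral formulas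
(`exists_coeff_eq_sum`). -/

open Module

/-! ### Trace duality for commuting extensions -/

section TraceDuality
variable {F B J : Type*} [Field F] [AddCommGroup B] [Module F B] [AddCommGroup J] [Module F J]

/-- The linear map `(u, c) ↦ (g c + u Y) - (a u + c p)`, whose kernel describes the commuting
extensions of `(p, Y)` by `(g, a)`. -/
def extensionDefect (g a : End F B) (p Y : End F J) :
    ((J →ₗ[F] B) × (J →ₗ[F] B)) →ₗ[F] (J →ₗ[F] B) where
  toFun x := (g ∘ₗ x.2 + x.1 ∘ₗ Y) - (a ∘ₗ x.1 + x.2 ∘ₗ p)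
  map_add' x y := by
    ext v
    simp
    abel
  map_smul' r x := by
    ext v
    simp [smul_sub]

/-- The trace pairing between `Hom(B, J)` and `Hom(J, B)`. -/
noncomputable def tracePairing (F B J : Type*) [Field F] [AddCommGroup B] [Module F B]
    [AddCommGroup J] [Module F J] : (B →ₗ[F] J) →ₗ[F] Dual F (J →ₗ[F] B) :=
  LinearMap.mk₂ F (fun ψ c => LinearMap.trace F J (ψ ∘ₗ c))
    (fun _ _ _ => by simp [LinearMap.add_comp]) (fun _ _ _ => by simp [LinearMap.smul_comp])
    (fun _ _ _ => by simp [LinearMap.comp_add]) (fun _ _ _ => by simp [LinearMap.comp_smul])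

theorem tracePairing_apply (ψ : B →ₗ[F] J) (c : J →ₗ[F] B) :
    tracePairing F B J ψ c = LinearMap.trace F J (ψ ∘ₗ c) := rfl

variable [FiniteDimensional F J]

/-- Rank one maps `c = f ⊗ b` suffice as tests: the trace of `χ ∘ c` is then `f (χ b)`. -/
theorem eq_of_forall_trace_comp_eq {ψ ψ' : B →ₗ[F] J}
    (h : ∀ c : J →ₗ[F] B, LinearMap.trace F J (ψ ∘ₗ c) = LinearMap.trace F J (ψ' ∘ₗ c)) :
    ψ = ψ' := by
  ext b
  rw [← sub_eq_zero, ← Module.forall_dual_apply_eq_zero_iff F (ψ b - ψ' b)]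
  intro f
  have key : ∀ χ : B →ₗ[F] J, LinearMap.trace F J (χ ∘ₗ f.smulRight b) = f (χ b) := by
    intro χ
    rw [← LinearMap.trace_smulRight f (χ b)]
    congr 1
    ext v
    simp
  have := h (f.smulRight b)
  rw [key, key] at this
  rw [map_sub, this, sub_self]

theorem tracePairing_injective : Function.Injective (tracePairing F B J) := fun ψ ψ' h =>
  eq_of_forall_trace_comp_eq fun c => by
    rw [← tracePairing_apply, ← tracePairing_apply, h]

/-- Cyclicity of the trace makes `ψ ↦ (Y ψ - ψ a, ψ g - p ψ)` the transpose of the defect map. The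
annihilator of the range is the kernel of this transpose, which consists of the intertwiners. -/
theorem tracePairing_mem_dualAnnihilator_iff (g a : End F B) (p Y : End F J) (ψ : B →ₗ[F] J) :
    tracePairing F B J ψ ∈ (LinearMap.range (extensionDefect g a p Y)).dualAnnihilator ↔
      ψ ∘ₗ g = p ∘ₗ ψ ∧ ψ ∘ₗ a = Y ∘ₗ ψ := by
  have key : ∀ u c : J →ₗ[F] B, tracePairing F B J ψ (extensionDefect g a p Y (u, c)) =
      (LinearMap.trace F J ((ψ ∘ₗ g) ∘ₗ c) - LinearMap.trace F J ((p ∘ₗ ψ) ∘ₗ c)) -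
      (LinearMap.trace F J ((ψ ∘ₗ a) ∘ₗ u) - LinearMap.trace F J ((Y ∘ₗ ψ) ∘ₗ u)) := by
    intro u c
    rw [tracePairing_apply]
    simp only [extensionDefect, LinearMap.coe_mk, AddHom.coe_mk, LinearMap.comp_sub,
      LinearMap.comp_add, map_sub, map_add]
    simp only [← LinearMap.comp_assoc]
    rw [LinearMap.trace_comp_comm' Y (ψ ∘ₗ u), LinearMap.trace_comp_comm' p (ψ ∘ₗ c)]
    simp only [LinearMap.comp_assoc]
    ring
  rw [Submodule.mem_dualAnnihilator]
  constructor
  · intro h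
    refine ⟨eq_of_forall_trace_comp_eq fun c => ?_, eq_of_forall_trace_comp_eq fun u => ?_⟩
    · have := h _ ⟨(0, c), rfl⟩
      rw [key] at this
      simpa [sub_eq_zero] using this
    · have := h _ ⟨(u, 0), rfl⟩
      rw [key] at this
      simp only [map_zero, LinearMap.comp_zero, sub_zero, zero_sub, neg_eq_zero] at this
      exact sub_eq_zero.1 this
  · rintro ⟨h1, h2⟩ _ ⟨⟨u, c⟩, rfl⟩
    rw [key, h1, h2, sub_self, sub_self, sub_self]

variable [FiniteDimensional F B]

/-- With `N = dim B · dim J` and `r` the rank, the kernel has dimension `2N - r` and the annihilator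
of the range has dimension `N - r`. -/
theorem finrank_ker_extensionDefect (g a : End F B) (p Y : End F J) :
    finrank F (LinearMap.ker (extensionDefect g a p Y)) = finrank F B * finrank F J +
      finrank F ((LinearMap.range (extensionDefect g a p Y)).dualAnnihilator.comap
        (tracePairing F B J)) := by
  have hdim : finrank F (B →ₗ[F] J) = finrank F (Dual F (J →ₗ[F] B)) := by
    rw [Subspace.dual_finrank_eq, finrank_linearMap, finrank_linearMap, mul_comm]
  let e := LinearEquiv.ofInjectiveOfFinrankEq (tracePairing F B J) tracePairing_injective hdim
  have he : (e : (B →ₗ[F] J) →ₗ[F] _) = tracePairing F B J := by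
    ext; rfl
  have h1 := LinearMap.finrank_range_add_finrank_ker (extensionDefect g a p Y)
  have h2 := Subspace.finrank_add_finrank_dualAnnihilator_eq
    (LinearMap.range (extensionDefect g a p Y))
  rw [← he, Submodule.comap_equiv_eq_map_symm, LinearEquiv.finrank_map_eq]
  rw [finrank_prod, finrank_linearMap] at h1
  rw [finrank_linearMap] at h2
  rw [mul_comm (finrank F B)]
  omega

/-- The number of commuting extensions of `(p, Y)` by `(g, a)`, in terms of the number of
equivariant maps in the opposite direction. -/
theorem card_commuting_extensions [Finite F] (g a : End F B) (p Y : End F J) :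
    Nat.card {x : (J →ₗ[F] B) × (J →ₗ[F] B) // g ∘ₗ x.2 + x.1 ∘ₗ Y = a ∘ₗ x.1 + x.2 ∘ₗ p} =
      Nat.card F ^ (finrank F B * finrank F J) *
        Nat.card {ψ : B →ₗ[F] J // ψ ∘ₗ g = p ∘ₗ ψ ∧ ψ ∘ₗ a = Y ∘ₗ ψ} := by
  have e1 : {x : (J →ₗ[F] B) × (J →ₗ[F] B) // g ∘ₗ x.2 + x.1 ∘ₗ Y = a ∘ₗ x.1 + x.2 ∘ₗ p} ≃
      LinearMap.ker (extensionDefect g a p Y) :=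
    Equiv.subtypeEquivRight fun x => by
      rw [LinearMap.mem_ker, ← sub_eq_zero]; rfl
  have e2 : {ψ : B →ₗ[F] J // ψ ∘ₗ g = p ∘ₗ ψ ∧ ψ ∘ₗ a = Y ∘ₗ ψ} ≃
      (LinearMap.range (extensionDefect g a p Y)).dualAnnihilator.comap (tracePairing F B J) :=
    Equiv.subtypeEquivRight fun ψ => by
      rw [Submodule.mem_comap, tracePairing_mem_dualAnnihilator_iff]
  rw [Nat.card_congr e1, Nat.card_congr e2,
    natCard_eq_pow_finrank (K := F) (V := LinearMap.ker (extensionDefect g a p Y)),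
    natCard_eq_pow_finrank (K := F)
      (V := (LinearMap.range (extensionDefect g a p Y)).dualAnnihilator.comap _), ← pow_add, finrank_ker_extensionDefect]

end TraceDuality

/-! ### Block upper triangular endomorphisms -/

section BlockEndomorphisms
variable {F B J : Type*} [Field F] [AddCommGroup B] [Module F B] [AddCommGroup J] [Module F J]

/-- The block upper triangular endomorphism of `B × J` with diagonal blocks `g`, `p` and
off-diagonal block `u`. -/
def blockEnd (g : End F B) (u : J →ₗ[F] B) (p : End F J) : End F (B × J) :=
  LinearMap.prod (g ∘ₗ LinearMap.fst F B J + u ∘ₗ LinearMap.snd F B J) (p ∘ₗ LinearMap.snd F B J)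

@[simp] theorem blockEnd_apply (g : End F B) (u : J →ₗ[F] B) (p : End F J) (x : B × J) :
    blockEnd g u p x = (g x.1 + u x.2, p x.2) := rfl

theorem blockEnd_mul (g a : End F B) (u c : J →ₗ[F] B) (p Y : End F J) :
    blockEnd g u p * blockEnd a c Y = blockEnd (g * a) (g ∘ₗ c + u ∘ₗ Y) (p * Y) := by
  refine LinearMap.ext fun x => ?_
  simp [add_assoc]

theorem blockEnd_inj {g a : End F B} {u c : J →ₗ[F] B} {p Y : End F J} :
    blockEnd g u p = blockEnd a c Y ↔ g = a ∧ u = c ∧ p = Y := by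
  refine ⟨fun h => ⟨?_, ?_, ?_⟩, by rintro ⟨rfl, rfl, rfl⟩; rfl⟩
  · ext b
    simpa using congrArg Prod.fst (LinearMap.congr_fun h (b, 0))
  · ext j
    simpa using congrArg Prod.fst (LinearMap.congr_fun h (0, j))
  · ext j
    simpa using congrArg Prod.snd (LinearMap.congr_fun h (0, j))

theorem commute_blockEnd_iff {g a : End F B} {u c : J →ₗ[F] B} {p Y : End F J}
    (h : Commute p Y) :
    Commute (blockEnd g u p) (blockEnd a c Y) ↔
      Commute g a ∧ g ∘ₗ c + u ∘ₗ Y = a ∘ₗ u + c ∘ₗ p := by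
  rw [commute_iff_eq, blockEnd_mul, blockEnd_mul, blockEnd_inj]
  exact ⟨fun H => ⟨H.1, H.2.1⟩, fun H => ⟨H.1, H.2, h⟩⟩

theorem exists_blockEnd_pow (a : End F B) (c : J →ₗ[F] B) (Y : End F J) (n : ℕ) :
    ∃ c', blockEnd a c Y ^ n = blockEnd (a ^ n) c' (Y ^ n) := by
  induction n with
  | zero =>
    refine ⟨0, LinearMap.ext fun x => ?_⟩
    simp
  | succ n ih =>
    obtain ⟨c', h⟩ := ih
    exact ⟨_, by rw [pow_succ, h, blockEnd_mul, ← pow_succ, ← pow_succ]⟩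

theorem isNilpotent_blockEnd_iff {a : End F B} {c : J →ₗ[F] B} {Y : End F J}
    (hY : IsNilpotent Y) : IsNilpotent (blockEnd a c Y) ↔ IsNilpotent a := by
  constructor
  · rintro ⟨n, hn⟩
    obtain ⟨c', h⟩ := exists_blockEnd_pow a c Y n
    refine ⟨n, ?_⟩
    have h0 : (0 : End F (B × J)) = blockEnd 0 0 0 := by
      refine LinearMap.ext fun x => ?_
      simp [Prod.ext_iff]
    rw [hn, h0, blockEnd_inj] at h
    exact h.1.symm
  · rintro ⟨n, hn⟩
    obtain ⟨k, hk⟩ := hY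
    obtain ⟨c', h⟩ := exists_blockEnd_pow a c Y (n + k)
    rw [pow_add a, hn, zero_mul, pow_add Y, hk, mul_zero] at h
    -- The power `n + k` has zero diagonal blocks, so it squares to zero.
    refine ⟨(n + k) * 2, ?_⟩
    rw [pow_mul, h, pow_two, blockEnd_mul]
    refine LinearMap.ext fun x => ?_
    simp

theorem isUnit_blockEnd_iff [FiniteDimensional F B] [FiniteDimensional F J] {g : End F B}
    {u : J →ₗ[F] B} {p : End F J} (hp : IsUnit p) : IsUnit (blockEnd g u p) ↔ IsUnit g := by
  rw [LinearMap.isUnit_iff_ker_eq_bot, LinearMap.isUnit_iff_ker_eq_bot,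
    LinearMap.ker_eq_bot', LinearMap.ker_eq_bot']
  rw [LinearMap.isUnit_iff_ker_eq_bot, LinearMap.ker_eq_bot'] at hp
  constructor
  · intro h b hb
    have := h (b, 0) (by simp [hb])
    simpa using this
  · rintro h ⟨b, j⟩ hx
    simp only [blockEnd_apply, Prod.mk_eq_zero] at hx
    obtain rfl := hp j hx.2
    rw [map_zero, add_zero] at hx
    simp [h b hx.1]

/-- Inducing `p` on the quotient `J` forces the lower row of blocks to be `(0, p)`; the upper row is
unrestricted. -/
theorem snd_comp_eq_iff {h : End F (B × J)} {p : End F J} :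
    LinearMap.snd F B J ∘ₗ h = p ∘ₗ LinearMap.snd F B J ↔
      blockEnd (LinearMap.fst F B J ∘ₗ h ∘ₗ LinearMap.inl F B J)
        (LinearMap.fst F B J ∘ₗ h ∘ₗ LinearMap.inr F B J) p = h := by
  constructor
  · intro H
    refine LinearMap.ext fun x => Prod.ext ?_ (LinearMap.congr_fun H x).symm
    simp only [blockEnd_apply, LinearMap.comp_apply, LinearMap.fst_apply, LinearMap.inl_apply,
      LinearMap.inr_apply]
    rw [← Prod.fst_add, ← map_add]
    simp
  · intro H
    rw [← H]
    rfl

/-- Every surjection `B × J → J` is the second projection up to an automorphism. -/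
theorem exists_linearEquiv_snd_comp_eq [FiniteDimensional F B] [FiniteDimensional F J]
    {φ : B × J →ₗ[F] J} (hφ : Function.Surjective φ) :
    ∃ e : (B × J) ≃ₗ[F] (B × J), LinearMap.snd F B J ∘ₗ e.toLinearMap = φ := by
  have h1 := LinearMap.finrank_range_add_finrank_ker φ
  rw [LinearMap.range_eq_top.2 hφ, finrank_top, finrank_prod] at h1
  obtain ⟨κ⟩ : Nonempty (B ≃ₗ[F] LinearMap.ker φ) :=
    FiniteDimensional.nonempty_linearEquiv_of_finrank_eq (by omega)
  obtain ⟨s, hs⟩ := LinearMap.exists_rightInverse_of_surjective φ (LinearMap.range_eq_top.2 hφ)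
  have hs' : ∀ j, φ (s j) = j := fun j => LinearMap.congr_fun hs j
  -- The map `f` identifies `B` with the kernel of `φ` and `J` with a complement given by a section;
  -- its inverse is the required automorphism.
  let f : End F (B × J) := LinearMap.coprod ((LinearMap.ker φ).subtype ∘ₗ κ.toLinearMap) s
  have hf : ∀ x, φ (f x) = x.2 := fun x => by
    have : φ (κ x.1) = 0 := (κ x.1).2
    simp [f, hs', this]
  have hinj : Function.Injective f := by
    rw [← LinearMap.ker_eq_bot, LinearMap.ker_eq_bot']
    rintro ⟨b, j⟩ hx
    have hj : j = 0 := by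
      have := hf (b, j)
      rw [hx, map_zero] at this
      exact this.symm
    subst hj
    simpa [f] using hx
  let e := LinearEquiv.ofInjectiveEndo f hinj
  refine ⟨e.symm, LinearMap.ext fun x => ?_⟩
  obtain ⟨y, rfl⟩ := e.surjective x
  change (e.symm (e y)).2 = φ (f y)
  rw [e.symm_apply_apply, hf]

end BlockEndomorphisms

/-! ### Counting intertwining triples -/

section Triples
variable {F : Type*} [Field F]

/-- Pairs of commuting endomorphisms of `V`, the first invertible and the second nilpotent. -/
def unitNilpotentPairs (F V : Type*) [Field F] [AddCommGroup V] [Module F V] :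
    Set (End F V × End F V) :=
  {x | IsUnit x.1 ∧ IsNilpotent x.2 ∧ Commute x.1 x.2}

/-- Linear maps `V → W` intertwining `g`, `a` with `p`, `Y`. -/
def intertwiners {V W : Type*} [AddCommGroup V] [Module F V] [AddCommGroup W] [Module F W]
    (g a : End F V) (p Y : End F W) : Set (V →ₗ[F] W) :=
  {ψ | ψ ∘ₗ g = p ∘ₗ ψ ∧ ψ ∘ₗ a = Y ∘ₗ ψ}

/-- Commuting pairs `(g, a)` on `V` together with an intertwiner to `(W, p, Y)`. -/
def intertwiningTriples (V : Type*) {W : Type*} [AddCommGroup V] [Module F V] [AddCommGroup W]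
    [Module F W] (p Y : End F W) : Set ((End F V × End F V) × (V →ₗ[F] W)) :=
  {x | x.1 ∈ unitNilpotentPairs F V ∧ x.2 ∈ intertwiners x.1.1 x.1.2 p Y}

variable {V V' W W' B J : Type*} [AddCommGroup V] [Module F V] [AddCommGroup V'] [Module F V']
  [AddCommGroup W] [Module F W] [AddCommGroup W'] [Module F W']
  [AddCommGroup B] [Module F B] [AddCommGroup J] [Module F J]

theorem conj_mem_unitNilpotentPairs_iff (e : V ≃ₗ[F] V') (x : End F V × End F V) :
    (e.conj x.1, e.conj x.2) ∈ unitNilpotentPairs F V' ↔ x ∈ unitNilpotentPairs F V := by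
  have h1 : IsUnit (e.conj x.1) ↔ IsUnit x.1 :=
    MulEquiv.isUnit_map (e.conjRingEquiv : End F V ≃+* End F V')
  have h2 : IsNilpotent (e.conj x.2) ↔ IsNilpotent x.2 :=
    IsNilpotent.map_iff (f := e.conjRingEquiv) e.conjRingEquiv.injective
  have h3 : Commute (e.conj x.1) (e.conj x.2) ↔ Commute x.1 x.2 := by
    rw [commute_iff_eq, commute_iff_eq, Module.End.mul_eq_comp, Module.End.mul_eq_comp,
      ← LinearEquiv.conj_comp, ← LinearEquiv.conj_comp, e.conj.injective.eq_iff]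
    rfl
  exact and_congr h1 (and_congr h2 h3)

theorem mem_intertwiners_congr (e : V ≃ₗ[F] V') (f : W ≃ₗ[F] W') {g a : End F V} {p Y : End F W}
    {ψ : V →ₗ[F] W} :
    e.arrowCongr f ψ ∈ intertwiners (e.conj g) (e.conj a) (f.conj p) (f.conj Y) ↔
      ψ ∈ intertwiners g a p Y := by
  have key : ∀ (h : End F V) (k : End F W),
      e.arrowCongr f ψ ∘ₗ e.conj h = f.conj k ∘ₗ e.arrowCongr f ψ ↔ ψ ∘ₗ h = k ∘ₗ ψ := by
    intro h k
    constructor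
    · intro H
      ext v
      simpa using LinearMap.congr_fun H (e v)
    · intro H
      ext v
      simpa using LinearMap.congr_fun H (e.symm v)
  exact and_congr (key g p) (key a Y)

/-- Transport of intertwining triples along linear equivalences. -/
noncomputable def intertwiningTriplesCongr (e : V ≃ₗ[F] V') (f : W ≃ₗ[F] W') (p Y : End F W) :
    intertwiningTriples V p Y ≃ intertwiningTriples V' (f.conj p) (f.conj Y) :=
  Equiv.subtypeEquiv ((e.conj.toEquiv.prodCongr e.conj.toEquiv).prodCongr
    (e.arrowCongr f).toEquiv) fun x =>
      and_congr (conj_mem_unitNilpotentPairs_iff e x.1).symm (mem_intertwiners_congr e f).symm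

/-- The order of the general linear group of `V`. -/
noncomputable def glCard (F V : Type*) [Field F] [AddCommGroup V] [Module F V] : ℕ :=
  Nat.card {g : End F V // IsUnit g}

theorem glCard_congr (e : V ≃ₗ[F] V') : glCard F V = glCard F V' :=
  Nat.card_congr (Equiv.subtypeEquiv e.conj.toEquiv fun _ =>
    (MulEquiv.isUnit_map (e.conjRingEquiv : End F V ≃+* End F V')).symm)

theorem mem_intertwiners_conj_iff (e : V ≃ₗ[F] V') {x : End F V × End F V} {p Y : End F W}
    {φ : V →ₗ[F] W} {ψ : V' →ₗ[F] W} (h : ψ ∘ₗ e.toLinearMap = φ) :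
    ψ ∈ intertwiners (e.conj x.1) (e.conj x.2) p Y ↔ φ ∈ intertwiners x.1 x.2 p Y := by
  have h2 : e.arrowCongr (LinearEquiv.refl F W) φ = ψ := by
    subst h
    ext v
    simp
  rw [← h2, ← mem_intertwiners_congr e (LinearEquiv.refl F W), LinearEquiv.conj_refl,
    LinearEquiv.conj_refl]

/-- Commuting pairs on `V` compatible with a fixed map `φ : V → W`. -/
def compatiblePairs (φ : V →ₗ[F] W) (p Y : End F W) : Set (End F V × End F V) :=
  {x | x ∈ unitNilpotentPairs F V ∧ φ ∈ intertwiners x.1 x.2 p Y}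

theorem card_compatiblePairs_congr (e : V ≃ₗ[F] V') {p Y : End F W}
    {φ : V →ₗ[F] W} {ψ : V' →ₗ[F] W} (h : ψ ∘ₗ e.toLinearMap = φ) :
    Nat.card (compatiblePairs φ p Y) = Nat.card (compatiblePairs ψ p Y) :=
  Nat.card_congr (Equiv.subtypeEquiv (e.conj.toEquiv.prodCongr e.conj.toEquiv) fun x =>
    and_congr (conj_mem_unitNilpotentPairs_iff e x).symm (mem_intertwiners_conj_iff e h).symm)

/-- The off-diagonal blocks of commuting block upper triangular endomorphisms. -/
def commutingBlocks (g a : End F B) (p Y : End F J) : Set ((J →ₗ[F] B) × (J →ₗ[F] B)) :=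
  {x | g ∘ₗ x.2 + x.1 ∘ₗ Y = a ∘ₗ x.1 + x.2 ∘ₗ p}

variable [FiniteDimensional F B] [FiniteDimensional F J]

/-- Commuting pairs over `(p, Y)` on `B × J` in terms of blocks. -/
noncomputable def compatiblePairsSndEquiv {p Y : End F J} (hp : IsUnit p) (hY : IsNilpotent Y)
    (hpY : Commute p Y) :
    (Σ x : unitNilpotentPairs F B, commutingBlocks x.1.1 x.1.2 p Y) ≃
      compatiblePairs (LinearMap.snd F B J) p Y :=
  Equiv.ofBijective
    (fun x => ⟨(blockEnd x.1.1.1 x.2.1.1 p, blockEnd x.1.1.2 x.2.1.2 Y),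
      ⟨(isUnit_blockEnd_iff hp).2 x.1.2.1, (isNilpotent_blockEnd_iff hY).2 x.1.2.2.1,
        (commute_blockEnd_iff hpY).2 ⟨x.1.2.2.2, x.2.2⟩⟩, rfl, rfl⟩) <| by
    constructor
    · rintro ⟨⟨⟨g, a⟩, h⟩, ⟨⟨u, c⟩, h'⟩⟩ ⟨⟨⟨g₂, a₂⟩, h₂⟩, ⟨⟨u₂, c₂⟩, h'₂⟩⟩ H
      obtain ⟨rfl, rfl, -⟩ := blockEnd_inj.1 (congrArg (fun z => z.1.1) H)
      obtain ⟨rfl, rfl, -⟩ := blockEnd_inj.1 (congrArg (fun z => z.1.2) H)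
      rfl
    · rintro ⟨⟨g, a⟩, h, hg, ha⟩
      rw [snd_comp_eq_iff] at hg ha
      generalize LinearMap.fst F B J ∘ₗ g ∘ₗ LinearMap.inl F B J = g' at hg
      generalize LinearMap.fst F B J ∘ₗ g ∘ₗ LinearMap.inr F B J = u at hg
      generalize LinearMap.fst F B J ∘ₗ a ∘ₗ LinearMap.inl F B J = a' at ha
      generalize LinearMap.fst F B J ∘ₗ a ∘ₗ LinearMap.inr F B J = c at ha
      subst hg ha
      obtain ⟨h1, h2, h3⟩ := h
      have h3 := (commute_blockEnd_iff hpY).1 h3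
      exact ⟨⟨⟨(g', a'), (isUnit_blockEnd_iff hp).1 h1, (isNilpotent_blockEnd_iff hY).1 h2,
        h3.1⟩, ⟨(u, c), h3.2⟩⟩, rfl⟩

/-- Automorphisms of `B × J` over an automorphism of `J` in terms of blocks. -/
noncomputable def unitsOverSndEquiv {p : End F J} (hp : IsUnit p) :
    {g : End F B // IsUnit g} × (J →ₗ[F] B) ≃
      {h : {h : End F (B × J) // IsUnit h} //
        LinearMap.snd F B J ∘ₗ h.1 = p ∘ₗ LinearMap.snd F B J} :=
  Equiv.ofBijective
    (fun x => ⟨⟨blockEnd x.1.1 x.2 p, (isUnit_blockEnd_iff hp).2 x.1.2⟩, rfl⟩) <| by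
    constructor
    · rintro ⟨⟨g, h⟩, u⟩ ⟨⟨g₂, h₂⟩, u₂⟩ H
      obtain ⟨rfl, rfl, -⟩ := blockEnd_inj.1 (congrArg (fun z => z.1.1) H)
      rfl
    · rintro ⟨⟨g, h⟩, hg⟩
      rw [snd_comp_eq_iff] at hg
      generalize LinearMap.fst F B J ∘ₗ g ∘ₗ LinearMap.inl F B J = g' at hg
      generalize LinearMap.fst F B J ∘ₗ g ∘ₗ LinearMap.inr F B J = u at hg
      subst hg
      exact ⟨⟨⟨g', (isUnit_blockEnd_iff hp).1 h⟩, u⟩, rfl⟩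

variable [Finite F]

omit [FiniteDimensional F B] [FiniteDimensional F J] in
theorem card_intertwiningTriples [FiniteDimensional F V] [FiniteDimensional F W] (p Y : End F W)
    [Fintype (unitNilpotentPairs F V)] :
    Nat.card (intertwiningTriples V p Y) =
      ∑ x : unitNilpotentPairs F V, Nat.card (intertwiners x.1.1 x.1.2 p Y) := by
  have : Finite (V →ₗ[F] W) := Module.finite_of_finite F
  let e : intertwiningTriples V p Y ≃
      Σ x : unitNilpotentPairs F V, intertwiners x.1.1 x.1.2 p Y :=
    { toFun := fun x => ⟨⟨x.1.1, x.2.1⟩, ⟨x.1.2, x.2.2⟩⟩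
      invFun := fun x => ⟨(x.1.1, x.2.1), x.1.2, x.2.2⟩
      left_inv := fun _ => rfl
      right_inv := fun _ => rfl }
  rw [Nat.card_congr e, Nat.card_sigma]

/-- Here duality enters: over each `(g, a)`, the extension data `J → B` are traded for intertwiners
`B → J`, at the cost of a factor independent of `(g, a)`. -/
theorem card_compatiblePairs_snd {p Y : End F J} (hp : IsUnit p) (hY : IsNilpotent Y)
    (hpY : Commute p Y) :
    Nat.card (compatiblePairs (LinearMap.snd F B J) p Y) =
      Nat.card F ^ (finrank F B * finrank F J) * Nat.card (intertwiningTriples B p Y) := by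
  have : Finite (J →ₗ[F] B) := Module.finite_of_finite F
  have : Finite (End F B) := Module.finite_of_finite F
  have : Fintype (unitNilpotentPairs F B) := Fintype.ofFinite _
  rw [← Nat.card_congr (compatiblePairsSndEquiv hp hY hpY), Nat.card_sigma,
    card_intertwiningTriples, Finset.mul_sum]
  exact Finset.sum_congr rfl fun x _ => card_commuting_extensions x.1.1 x.1.2 p Y

/-- The automorphism group acts transitively on the surjections onto `J`, and the stabilizer of the
projection consists of the invertible block matrices with `p = 1`. -/
theorem glCard_prod :
    glCard F (B × J) = Nat.card {φ : B × J →ₗ[F] J // Function.Surjective φ} *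
      (glCard F B * Nat.card F ^ (finrank F B * finrank F J)) := by
  have : Finite (B × J →ₗ[F] J) := Module.finite_of_finite F
  have : Finite (End F (B × J)) := Module.finite_of_finite F
  have : Fintype {φ : B × J →ₗ[F] J // Function.Surjective φ} := Fintype.ofFinite _
  let f : {h : End F (B × J) // IsUnit h} → {φ : B × J →ₗ[F] J // Function.Surjective φ} :=
    fun h => ⟨LinearMap.snd F B J ∘ₗ h.1,
      Prod.snd_surjective.comp ((Module.End.isUnit_iff _).1 h.2).surjective⟩
  rw [glCard, ← Nat.card_congr (Equiv.sigmaFiberEquiv f), Nat.card_sigma,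
    Finset.sum_congr rfl (g := fun _ => glCard F B * Nat.card F ^ (finrank F B * finrank F J)),
    Finset.sum_const, smul_eq_mul, Finset.card_univ, ← Nat.card_eq_fintype_card]
  rintro ⟨φ, hφ⟩ -
  obtain ⟨e, rfl⟩ := exists_linearEquiv_snd_comp_eq hφ
  have hJ : Nat.card (J →ₗ[F] B) = Nat.card F ^ (finrank F B * finrank F J) := by
    rw [natCard_eq_pow_finrank (K := F), finrank_linearMap, mul_comm]
  rw [← hJ, glCard, ← Nat.card_prod, Nat.card_congr (unitsOverSndEquiv isUnit_one)]
  -- Right translation by `e⁻¹` carries the fibre over `snd ∘ e` to the fibre over `snd`.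
  let u : (End F (B × J))ˣ := LinearMap.GeneralLinearGroup.ofLinearEquiv e
  refine Nat.card_congr (Equiv.subtypeEquiv (Equiv.subtypeEquiv u⁻¹.mulRight fun h => ?_)
    fun h => ?_)
  · simp
  · rw [Subtype.ext_iff]
    change LinearMap.snd F B J ∘ₗ h.1 = LinearMap.snd F B J ∘ₗ e.toLinearMap ↔
      LinearMap.snd F B J ∘ₗ (h.1 ∘ₗ e.symm.toLinearMap) = LinearMap.snd F B J
    rw [← LinearMap.comp_assoc, LinearEquiv.comp_toLinearMap_symm_eq]

/-- Every surjection contributes as much as the projection. The factor `q^(dim B · dim J)` from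
duality is the one that occurs in `glCard_prod`, so it cancels. -/
theorem card_surjective_intertwiningTriples_prod {p Y : End F J} (hp : IsUnit p)
    (hY : IsNilpotent Y) (hpY : Commute p Y) :
    Nat.card {x : intertwiningTriples (B × J) p Y // Function.Surjective x.1.2} * glCard F B =
      glCard F (B × J) * Nat.card (intertwiningTriples B p Y) := by
  have : Finite (B × J →ₗ[F] J) := Module.finite_of_finite F
  have : Finite (End F (B × J)) := Module.finite_of_finite F
  have : Fintype {φ : B × J →ₗ[F] J // Function.Surjective φ} := Fintype.ofFinite _
  let e : {x : intertwiningTriples (B × J) p Y // Function.Surjective x.1.2} ≃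
      Σ φ : {φ : B × J →ₗ[F] J // Function.Surjective φ}, compatiblePairs φ.1 p Y :=
    { toFun := fun x => ⟨⟨x.1.1.2, x.2⟩, ⟨x.1.1.1, x.1.2⟩⟩
      invFun := fun x => ⟨⟨(x.2.1, x.1.1), x.2.2⟩, x.1.2⟩
      left_inv := fun _ => rfl
      right_inv := fun _ => rfl }
  rw [Nat.card_congr e, Nat.card_sigma,
    Finset.sum_congr rfl (g := fun _ => Nat.card F ^ (finrank F B * finrank F J) *
      Nat.card (intertwiningTriples B p Y)),
    Finset.sum_const, smul_eq_mul, Finset.card_univ, glCard_prod, ← Nat.card_eq_fintype_card]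
  · ring
  · rintro ⟨φ, hφ⟩ -
    obtain ⟨e, he⟩ := exists_linearEquiv_snd_comp_eq hφ
    rw [card_compatiblePairs_congr e he, card_compatiblePairs_snd hp hY hpY]

end Triples

/-! ### Masses and the decomposition by images -/

section Mass
variable {F : Type*} [Field F]
variable {V W W' J : Type*} [AddCommGroup V] [Module F V]
  [AddCommGroup W] [Module F W] [AddCommGroup W'] [Module F W'] [AddCommGroup J] [Module F J]

/-- The number of intertwining triples on a `k`-dimensional space, weighted by the order of
`GL_k`. -/
noncomputable def intertwiningMass (k : ℕ) (p Y : End F W) : ℚ :=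
  Nat.card (intertwiningTriples (Fin k → F) p Y) / glCard F (Fin k → F)

theorem glCard_pos [Finite F] [FiniteDimensional F V] : 0 < glCard F V := by
  have : Finite (End F V) := Module.finite_of_finite F
  have : Nonempty {g : End F V // IsUnit g} := ⟨⟨1, isUnit_one⟩⟩
  exact Nat.card_pos

theorem intertwiningMass_eq [FiniteDimensional F V] (p Y : End F W) :
    intertwiningMass (finrank F V) p Y =
      (Nat.card (intertwiningTriples V p Y) : ℚ) / glCard F V := by
  let e : V ≃ₗ[F] (Fin (finrank F V) → F) :=
    LinearEquiv.ofFinrankEq _ _ (by simp)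
  rw [intertwiningMass, ← glCard_congr e,
    Nat.card_congr (intertwiningTriplesCongr e (LinearEquiv.refl F W) p Y),
    LinearEquiv.conj_refl, LinearEquiv.conj_refl]

theorem intertwiningMass_conj (k : ℕ) (f : W ≃ₗ[F] W') (p Y : End F W) :
    intertwiningMass k (f.conj p) (f.conj Y) = intertwiningMass k p Y := by
  rw [intertwiningMass, intertwiningMass,
    Nat.card_congr (intertwiningTriplesCongr (LinearEquiv.refl F _) f p Y)]

/-- Triples whose intertwiner is surjective are counted by triples on the kernel. -/
theorem card_surjective_intertwiningTriples [Finite F] [FiniteDimensional F J] (k : ℕ)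
    {p Y : End F J} (hp : IsUnit p) (hY : IsNilpotent Y) (hpY : Commute p Y) :
    (Nat.card {x : intertwiningTriples (Fin k → F) p Y // Function.Surjective x.1.2} : ℚ) /
      glCard F (Fin k → F) =
      if finrank F J ≤ k then intertwiningMass (k - finrank F J) p Y else 0 := by
  split_ifs with hk
  · let B := Fin (k - finrank F J) → F
    let e : (Fin k → F) ≃ₗ[F] B × J := LinearEquiv.ofFinrankEq _ _ (by simp [B]; omega)
    have h1 := card_surjective_intertwiningTriples_prod (B := B) hp hY hpY
    have h2 : {x : intertwiningTriples (Fin k → F) p Y // Function.Surjective x.1.2} ≃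
        {x : intertwiningTriples (B × J) p Y // Function.Surjective x.1.2} :=
      Equiv.subtypeEquiv (intertwiningTriplesCongr e (LinearEquiv.refl F J) p Y) fun x =>
        (e.symm.surjective.of_comp_iff x.1.2).symm
    have hB : (glCard F B : ℚ) ≠ 0 := by exact_mod_cast glCard_pos.ne'
    have hBJ : (glCard F (B × J) : ℚ) ≠ 0 := by exact_mod_cast glCard_pos.ne'
    rw [Nat.card_congr h2, glCard_congr e, intertwiningMass, div_eq_div_iff hBJ hB]
    rw [mul_comm (glCard F (B × J))] at h1
    exact_mod_cast h1
  · have : IsEmpty {x : intertwiningTriples (Fin k → F) p Y // Function.Surjective x.1.2} :=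
      ⟨fun x => hk (by simpa using LinearMap.finrank_le_finrank_of_surjective x.2)⟩
    simp

/-- The subspaces invariant under both `p` and `Y`. -/
def commonInvariants (p Y : End F W) : Set (Submodule F W) :=
  {J | (∀ x ∈ J, p x ∈ J) ∧ ∀ x ∈ J, Y x ∈ J}

theorem range_mem_commonInvariants {p Y : End F W} {x : (End F V × End F V) × (V →ₗ[F] W)}
    (hx : x ∈ intertwiningTriples V p Y) :
    LinearMap.range x.2 ∈ commonInvariants p Y := by
  obtain ⟨-, h1, h2⟩ := hx
  constructor
  · rintro _ ⟨v, rfl⟩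
    exact ⟨x.1.1 v, LinearMap.congr_fun h1 v⟩
  · rintro _ ⟨v, rfl⟩
    exact ⟨x.1.2 v, LinearMap.congr_fun h2 v⟩

/-- Triples with a given image of the intertwiner. -/
def intertwiningTriplesRangeEquiv {p Y : End F W} (J : commonInvariants p Y) :
    {x : intertwiningTriples V p Y // LinearMap.range x.1.2 = J.1} ≃
      {x : intertwiningTriples V (p.restrict J.2.1) (Y.restrict J.2.2) //
        Function.Surjective x.1.2} where
  toFun x := ⟨⟨(x.1.1.1, x.1.1.2.codRestrict J.1 fun v =>
      x.2.le (LinearMap.mem_range_self x.1.1.2 v)),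
    x.1.2.1, LinearMap.ext fun v => Subtype.ext (LinearMap.congr_fun x.1.2.2.1 v),
    LinearMap.ext fun v => Subtype.ext (LinearMap.congr_fun x.1.2.2.2 v)⟩, by
      rintro ⟨w, hw⟩
      rw [← x.2] at hw
      obtain ⟨v, hv⟩ := hw
      exact ⟨v, Subtype.ext hv⟩⟩
  invFun x := ⟨⟨(x.1.1.1, J.1.subtype ∘ₗ x.1.1.2), x.1.2.1,
    LinearMap.ext fun v => congrArg Subtype.val (LinearMap.congr_fun x.1.2.2.1 v),
    LinearMap.ext fun v => congrArg Subtype.val (LinearMap.congr_fun x.1.2.2.2 v)⟩, by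
      rw [LinearMap.range_comp, LinearMap.range_eq_top.2 x.2, Submodule.map_top,
        Submodule.range_subtype]⟩
  left_inv _ := rfl
  right_inv _ := rfl

theorem isUnit_restrict [FiniteDimensional F W] {p : End F W} (hp : IsUnit p)
    {J : Submodule F W} (hJ : ∀ x ∈ J, p x ∈ J) : IsUnit (p.restrict hJ) := by
  rw [LinearMap.isUnit_iff_ker_eq_bot, LinearMap.ker_eq_bot] at hp ⊢
  intro x y hxy
  exact Subtype.ext (hp (congrArg Subtype.val hxy))

theorem commute_restrict {p Y : End F W} (h : Commute p Y) {J : Submodule F W}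
    (hp : ∀ x ∈ J, p x ∈ J) (hY : ∀ x ∈ J, Y x ∈ J) :
    Commute (p.restrict hp) (Y.restrict hY) :=
  LinearMap.ext fun x => Subtype.ext (LinearMap.congr_fun h.eq x.1)

/-- The mass of `W` as a sum over the possible images of the intertwiner. -/
theorem intertwiningMass_eq_sum [Finite F] [FiniteDimensional F W] (k : ℕ) {p Y : End F W}
    (hp : IsUnit p) (hY : IsNilpotent Y) (hpY : Commute p Y) [Fintype (commonInvariants p Y)] :
    intertwiningMass k p Y = ∑ J : commonInvariants p Y,
      if finrank F J.1 ≤ k then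
        intertwiningMass (k - finrank F J.1) (p.restrict J.2.1) (Y.restrict J.2.2) else 0 := by
  have : Finite ((Fin k → F) →ₗ[F] W) := Module.finite_of_finite F
  have : Finite (End F (Fin k → F)) := Module.finite_of_finite F
  let f : intertwiningTriples (Fin k → F) p Y → commonInvariants p Y :=
    fun x => ⟨LinearMap.range x.1.2, range_mem_commonInvariants x.2⟩
  rw [intertwiningMass, ← Nat.card_congr (Equiv.sigmaFiberEquiv f), Nat.card_sigma,
    Nat.cast_sum, Finset.sum_div]
  refine Finset.sum_congr rfl fun J _ => ?_
  rw [← card_surjective_intertwiningTriples k (isUnit_restrict hp J.2.1)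
    (Module.End.isNilpotent.restrict J.2.2 hY) (commute_restrict hpY J.2.1 J.2.2),
    ← Nat.card_congr (intertwiningTriplesRangeEquiv J)]
  congr 2
  exact Nat.card_congr (Equiv.subtypeEquivRight fun x => Subtype.ext_iff)

end Mass

/-! ### Rationality of the mass series -/

section Series
variable {F : Type*} [Field F]
variable {W W' : Type*} [AddCommGroup W] [Module F W] [AddCommGroup W'] [Module F W']

/-- The generating function of the masses of `(W, p, Y)`. -/
noncomputable def massSeries (p Y : End F W) : PowerSeries ℚ :=
  PowerSeries.mk fun k => intertwiningMass k p Y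

theorem massSeries_conj (f : W ≃ₗ[F] W') (p Y : End F W) :
    massSeries (f.conj p) (f.conj Y) = massSeries p Y := by
  simp [massSeries, intertwiningMass_conj]

theorem massSeries_eq_sum [Finite F] [FiniteDimensional F W] {p Y : End F W}
    (hp : IsUnit p) (hY : IsNilpotent Y) (hpY : Commute p Y) [Fintype (commonInvariants p Y)] :
    massSeries p Y = ∑ J : commonInvariants p Y,
      PowerSeries.X ^ finrank F J.1 *
        massSeries (p.restrict J.2.1) (Y.restrict J.2.2) := by
  ext k
  rw [massSeries, PowerSeries.coeff_mk, intertwiningMass_eq_sum k hp hY hpY, map_sum]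
  refine Finset.sum_congr rfl fun J _ => ?_
  rw [PowerSeries.coeff_X_pow_mul', massSeries, PowerSeries.coeff_mk]

theorem top_mem_commonInvariants (p Y : End F W) : ⊤ ∈ commonInvariants p Y :=
  ⟨fun _ _ => trivial, fun _ _ => trivial⟩

theorem massSeries_restrict_top (p Y : End F W) :
    massSeries (p.restrict (top_mem_commonInvariants p Y).1)
      (Y.restrict (top_mem_commonInvariants p Y).2) = massSeries p Y := by
  rw [← massSeries_conj Submodule.topEquiv]
  rfl

theorem natDegree_prod_one_sub_X_pow_le (s : Finset ℕ) :
    (∏ j ∈ s, (1 - Polynomial.X ^ (j + 1) : Polynomial ℚ)).natDegree ≤ ∑ j ∈ s, (j + 1) := by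
  refine (Polynomial.natDegree_prod_le _ _).trans (Finset.sum_le_sum fun j _ => ?_)
  refine (Polynomial.natDegree_sub_le _ _).trans ?_
  simp

/-- Degree bookkeeping for the induction: a subspace of any dimension `d ≤ m` yields the same bound,
the triangular number `1 + ⋯ + m`. -/
theorem add_triangle_add_sum_Ico_eq {d m : ℕ} (h : d ≤ m) :
    d + d * (d - 1) / 2 + ∑ j ∈ Finset.Ico d m, (j + 1) = (m + 1) * (m + 1 - 1) / 2 := by
  rw [← Finset.sum_range_id, ← Finset.sum_range_id, Finset.sum_Ico_add' (fun j => j),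
    add_comm d, ← Finset.sum_range_succ, Finset.range_eq_Ico, Finset.range_eq_Ico,
    Finset.sum_Ico_consecutive (fun j => j) (Nat.zero_le _) (by omega)]

/-- Up to the universal factor `C`, the generating function of the masses of a space of
dimension `m` is a polynomial of degree at most `m(m-1)/2` over `∏ (1 - X^j)`. -/
theorem exists_massSeries_mul_eq.{u} {F : Type*} [Field F] [Finite F] (C : PowerSeries ℚ)
    (hC : ∀ (W : Type u) [AddCommGroup W] [Module F W] [Subsingleton W] (p Y : End F W),
      massSeries p Y = C) (m : ℕ) :
    ∀ (W : Type u) [AddCommGroup W] [Module F W] [FiniteDimensional F W] (p Y : End F W),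
      IsUnit p → IsNilpotent Y → Commute p Y → finrank F W = m →
      ∃ Q : Polynomial ℚ, Q.natDegree ≤ m * (m - 1) / 2 ∧
        massSeries p Y * (∏ j ∈ Finset.range m, (1 - Polynomial.X ^ (j + 1) : Polynomial ℚ) :
          Polynomial ℚ) = C * Q := by
  induction m using Nat.strong_induction_on with
  | _ m ih =>
    intro W _ _ _ p Y hp hY hpY hm
    rcases m with _ | m
    · have : Subsingleton W := finrank_zero_iff.1 hm
      exact ⟨1, by simp, by simp [hC]⟩
    · have : Finite W := Module.finite_of_finite F
      have : Fintype (commonInvariants p Y) := Fintype.ofFinite _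
      have hlt : ∀ J : {J : commonInvariants p Y // J ≠ ⟨⊤, top_mem_commonInvariants p Y⟩},
          finrank F J.1.1 < m + 1 := fun J => by
        rw [← hm]
        exact Submodule.finrank_lt fun h => J.2 (Subtype.ext h)
      choose Q hQ1 hQ2 using fun J :
          {J : commonInvariants p Y // J ≠ ⟨⊤, top_mem_commonInvariants p Y⟩} =>
        ih (finrank F J.1.1) (hlt J) J.1.1 (p.restrict J.1.2.1) (Y.restrict J.1.2.2)
          (isUnit_restrict hp _) (Module.End.isNilpotent.restrict J.1.2.2 hY)
          (commute_restrict hpY _ _) rfl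
      classical
      -- The summand `J = ⊤` is `X^(m+1)` times the series itself and moves to the left.
      have hrec : massSeries p Y * (1 - PowerSeries.X ^ (m + 1)) =
          ∑ J : {J : commonInvariants p Y // J ≠ ⟨⊤, top_mem_commonInvariants p Y⟩},
            PowerSeries.X ^ finrank F J.1.1 *
              massSeries (p.restrict J.1.2.1) (Y.restrict J.1.2.2) := by
        rw [mul_sub, mul_one, sub_eq_iff_eq_add]
        conv_lhs => rw [massSeries_eq_sum hp hY hpY]
        rw [Fintype.sum_eq_add_sum_subtype_ne _ ⟨⊤, top_mem_commonInvariants p Y⟩, add_comm]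
        congr 1
        rw [massSeries_restrict_top, finrank_top, hm, mul_comm]
      -- The last factor `1 - X^(m+1)` is absorbed by `hrec`. The induction hypothesis uses the
      -- factors up to `dim J`, leaving those with exponents `dim J + 1, …, m`.
      refine ⟨∑ J, Polynomial.X ^ finrank F J.1.1 * Q J *
        ∏ j ∈ Finset.Ico (finrank F J.1.1) m, (1 - Polynomial.X ^ (j + 1)), ?_, ?_⟩
      · refine Polynomial.natDegree_sum_le_of_forall_le _ _ fun J _ => ?_
        rw [← add_triangle_add_sum_Ico_eq (Nat.lt_succ_iff.1 (hlt J))]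
        refine Polynomial.natDegree_mul_le.trans (add_le_add ?_
          (natDegree_prod_one_sub_X_pow_le _))
        refine Polynomial.natDegree_mul_le.trans (add_le_add ?_ (hQ1 J))
        simp
      · rw [Finset.prod_range_succ, mul_comm (∏ j ∈ _, _), Polynomial.coe_mul, ← mul_assoc]
        have h1 : ((1 - Polynomial.X ^ (m + 1) : Polynomial ℚ) : PowerSeries ℚ) =
            1 - PowerSeries.X ^ (m + 1) := by simp
        rw [h1, hrec, Finset.sum_mul, ← Polynomial.coeToPowerSeries.ringHom_apply (φ := ∑ J, _),
          map_sum, Finset.mul_sum]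
        refine Finset.sum_congr rfl fun J _ => ?_
        rw [← Finset.prod_range_mul_prod_Ico _ (Nat.lt_succ_iff.1 (hlt J)),
          Polynomial.coe_mul, mul_assoc, ← mul_assoc (massSeries _ _), hQ2,
          Polynomial.coeToPowerSeries.ringHom_apply, Polynomial.coe_mul, Polynomial.coe_mul,
          Polynomial.coe_pow, Polynomial.coe_X]
        ring

end Series

/-! ### Nilpotent conjugacy classes and their independence of the field -/

section NilpotentClasses
open Polynomial

theorem X_pow_dvd_X_pow_mul_iff {R : Type*} [CommRing R] [IsDomain R] (l n : ℕ) (g : R[X]) :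
    X ^ l ∣ X ^ n * g ↔ X ^ (l - n) ∣ g := by
  rcases le_total l n with h | h
  · rw [Nat.sub_eq_zero_of_le h, pow_zero]
    exact iff_of_true ((pow_dvd_pow _ h).mul_right g) (one_dvd g)
  · obtain ⟨k, rfl⟩ := Nat.exists_eq_add_of_le h
    rw [Nat.add_sub_cancel_left, pow_add]
    exact mul_dvd_mul_iff_left (pow_ne_zero _ X_ne_zero)

/-- The `F[X]`-module on which `X` acts nilpotently with Jordan blocks of sizes `μ i`. -/
abbrev JordanModule (F : Type*) [Field F] {ι : Type*} (μ : ι → ℕ) : Type _ :=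
  (i : ι) → F[X] ⧸ (Ideal.span {(X : F[X]) ^ μ i})

variable {F : Type*} [Field F]

instance finite_quotient_X_pow (l : ℕ) :
    FiniteDimensional F (F[X] ⧸ (Ideal.span {(X : F[X]) ^ l})) :=
  (monic_X_pow l).finite_adjoinRoot

/-- The `X^n`-torsion is generated by `X^(l-n)`, with truncated subtraction, and so is a copy of
`F[X]/(X^(min n l))`. -/
theorem card_torsion_quotient_X_pow [Finite F] (l n : ℕ) :
    Nat.card {v : F[X] ⧸ (Ideal.span {(X : F[X]) ^ l}) // (X : F[X]) ^ n • v = 0} =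
      Nat.card F ^ min n l := by
  let θ : F[X] →ₗ[F[X]] F[X] ⧸ (Ideal.span {(X : F[X]) ^ l}) :=
    (Submodule.mkQ _) ∘ₗ LinearMap.mulLeft F[X] ((X : F[X]) ^ (l - n))
  have hker : LinearMap.ker θ = Ideal.span {(X : F[X]) ^ min n l} := by
    ext g
    rw [LinearMap.mem_ker, Ideal.mem_span_singleton]
    change Ideal.Quotient.mk (Ideal.span {(X : F[X]) ^ l}) (X ^ (l - n) * g) = 0 ↔ _
    rw [Ideal.Quotient.eq_zero_iff_mem, Ideal.mem_span_singleton, X_pow_dvd_X_pow_mul_iff,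
      show l - (l - n) = min n l by omega]
  have hrange : ∀ v, v ∈ LinearMap.range θ ↔ (X : F[X]) ^ n • v = 0 := by
    intro v
    obtain ⟨g, rfl⟩ := Ideal.Quotient.mk_surjective v
    change _ ↔ Ideal.Quotient.mk (Ideal.span {(X : F[X]) ^ l}) (X ^ n * g) = 0
    rw [Ideal.Quotient.eq_zero_iff_mem, Ideal.mem_span_singleton, X_pow_dvd_X_pow_mul_iff]
    constructor
    · rintro ⟨f, hf⟩
      replace hf : Ideal.Quotient.mk (Ideal.span {(X : F[X]) ^ l}) (X ^ (l - n) * f) =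
        Ideal.Quotient.mk _ g := hf
      rw [Ideal.Quotient.eq, Ideal.mem_span_singleton] at hf
      have := (pow_dvd_pow (X : F[X]) (Nat.sub_le l n)).trans hf
      exact (dvd_sub_right (dvd_mul_right _ _)).1 this
    · rintro ⟨f, rfl⟩
      exact ⟨f, rfl⟩
  have e := θ.quotKerEquivRange.toEquiv.trans (Equiv.subtypeEquivRight hrange)
  rw [← Nat.card_congr e, hker, natCard_eq_pow_finrank (K := F),
    finrank_quotient_span_eq_natDegree, natDegree_X_pow]

theorem finrank_jordanModule {ι : Type*} [Fintype ι] (μ : ι → ℕ) :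
    finrank F (JordanModule F μ) = ∑ i, μ i := by
  rw [finrank_pi_fintype]
  exact Finset.sum_congr rfl fun i _ => by
    rw [finrank_quotient_span_eq_natDegree, natDegree_X_pow]

theorem card_torsion_jordanModule [Finite F] {ι : Type*} [Fintype ι] (μ : ι → ℕ) (n : ℕ) :
    Nat.card {v : JordanModule F μ // (X : F[X]) ^ n • v = 0} =
      Nat.card F ^ ∑ i, min n (μ i) := by
  let e : {v : JordanModule F μ // (X : F[X]) ^ n • v = 0} ≃
      ((i : ι) → {v : F[X] ⧸ (Ideal.span {(X : F[X]) ^ μ i}) // (X : F[X]) ^ n • v = 0}) :=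
    { toFun := fun v i => ⟨v.1 i, congrFun v.2 i⟩
      invFun := fun v => ⟨fun i => (v i).1, funext fun i => (v i).2⟩
      left_inv := fun _ => rfl
      right_inv := fun _ => rfl }
  rw [Nat.card_congr e, Nat.card_pi, ← Finset.prod_pow_eq_pow_sum]
  exact Finset.prod_congr rfl fun i _ => card_torsion_quotient_X_pow _ _

variable {V : Type*} [AddCommGroup V] [Module F V]

/-- The dimensions of the kernels of the powers of an endomorphism. -/
noncomputable def kernelDims (a : End F V) (n : ℕ) : ℕ :=
  finrank F (LinearMap.ker (a ^ n))

theorem map_pow_eq_X_pow_smul {M : Type*} [AddCommGroup M] [Module F M] [Module F[X] M]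
    {a : End F V} (e : V ≃ₗ[F] M) (he : ∀ v, e (a v) = (X : F[X]) • e v) (n : ℕ) (v : V) :
    e ((a ^ n) v) = (X : F[X]) ^ n • e v := by
  induction n generalizing v with
  | zero => simp
  | succ n ih => rw [pow_succ, Module.End.mul_apply, ih, he, pow_succ, mul_smul]

theorem kernelDims_eq [Finite F] [FiniteDimensional F V] {ι : Type*} [Fintype ι] {μ : ι → ℕ}
    {a : End F V} (e : V ≃ₗ[F] JordanModule F μ) (he : ∀ v, e (a v) = (X : F[X]) • e v) :
    kernelDims a = fun n => ∑ i, min n (μ i) := by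
  funext n
  -- Since `q > 1`, dimensions may be compared by counting kernel vectors.
  refine Nat.pow_right_injective (Finite.one_lt_card (α := F)) ?_
  change Nat.card F ^ kernelDims a n = Nat.card F ^ ∑ i, min n (μ i)
  rw [kernelDims, ← natCard_eq_pow_finrank, ← card_torsion_jordanModule]
  refine Nat.card_congr (Equiv.subtypeEquiv e.toEquiv fun v => ?_)
  change _ ↔ (X : F[X]) ^ n • e v = 0
  rw [← map_pow_eq_X_pow_smul e he, LinearMap.mem_ker, LinearEquiv.map_eq_zero_iff]

/-- Jordan decomposition of a nilpotent endomorphism. -/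
theorem exists_jordanModule_equiv [FiniteDimensional F V] {a : End F V} (ha : IsNilpotent a) :
    ∃ (d : ℕ) (μ : Fin d → ℕ) (e : V ≃ₗ[F] JordanModule F μ),
      ∀ v, e (a v) = (X : F[X]) • e v := by
  obtain ⟨n, hn⟩ := ha
  obtain ⟨d, μ, ⟨e⟩⟩ := Module.torsion_by_prime_power_decomposition (M := AEval' a)
    (p := (X : F[X])) irreducible_X ((Submodule.isTorsion'_powers_iff _).2 fun x => ⟨n, by
      obtain ⟨v, rfl⟩ := (AEval'.of a).surjective x
      rw [AEval'.X_pow_smul_of, hn, zero_smul, map_zero]⟩)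
  let e' := e.trans (DirectSum.linearEquivFunOnFintype F[X] (Fin d) _)
  refine ⟨d, μ, (AEval'.of a).trans (e'.restrictScalars F), fun v => ?_⟩
  change e' (AEval'.of a (a v)) = X • e' (AEval'.of a v)
  rw [← AEval'.X_smul_of, map_smul]

/-- The negative second difference of `n ↦ min n t` is the indicator of `n + 1 = t`, so kernel
dimensions recover the number of blocks of each positive size. -/
theorem card_fiber_add_eq (d : ℕ) (μ : Fin d → ℕ) (v : ℕ) :
    Fintype.card {i // μ i = v + 1} + (∑ i, min v (μ i) + ∑ i, min (v + 2) (μ i)) =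
      2 * ∑ i, min (v + 1) (μ i) := by
  rw [Fintype.card_subtype, Finset.card_filter, ← Finset.sum_add_distrib,
    ← Finset.sum_add_distrib, Finset.mul_sum]
  refine Finset.sum_congr rfl fun i _ => ?_
  split_ifs <;> omega

/-- Blocks of size zero do not matter. -/
noncomputable def jordanModuleNonzeroEquiv {ι : Type*} (μ : ι → ℕ) :
    JordanModule F μ ≃ₗ[F[X]] JordanModule F fun i : {i // μ i ≠ 0} => μ i.1 :=
  LinearEquiv.ofBijective (LinearMap.pi fun i => LinearMap.proj i.1) <| by
    classical
    have hs : ∀ i, μ i = 0 → Subsingleton (F[X] ⧸ (Ideal.span {(X : F[X]) ^ μ i})) := by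
      intro i hi
      rw [hi, pow_zero, Ideal.span_singleton_one]
      exact Ideal.Quotient.subsingleton_iff.2 rfl
    constructor
    · intro x y h
      funext i
      by_cases hi : μ i = 0
      · exact (hs i hi).elim _ _
      · exact congrFun h ⟨i, hi⟩
    · intro y
      refine ⟨fun i => if hi : μ i ≠ 0 then y ⟨i, hi⟩ else 0, ?_⟩
      funext i
      simp [i.2]

theorem exists_equiv_of_sum_min_eq {d d' : ℕ} {μ : Fin d → ℕ} {μ' : Fin d' → ℕ}
    (h : ∀ n, ∑ i, min n (μ i) = ∑ i, min n (μ' i)) :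
    ∃ σ : {i // μ i ≠ 0} ≃ {i // μ' i ≠ 0}, ∀ i, μ' (σ i) = μ i := by
  have hcard : ∀ v : ℕ, v ≠ 0 → Fintype.card {i // μ i = v} = Fintype.card {i // μ' i = v} := by
    intro v hv
    obtain ⟨v, rfl⟩ := Nat.exists_eq_succ_of_ne_zero hv
    have h1 := card_fiber_add_eq d μ v
    have h2 := card_fiber_add_eq d' μ' v
    rw [h, h, h] at h1
    have := h1.trans h2.symm
    simpa using this
  have hσ : ∀ v : {v : ℕ // v ≠ 0}, Nonempty ({i : {i // μ i ≠ 0} // μ i.1 = v.1} ≃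
      {i : {i // μ' i ≠ 0} // μ' i.1 = v.1}) := by
    intro v
    have e : ∀ {k : ℕ} (ν : Fin k → ℕ), {i : {i // ν i ≠ 0} // ν i.1 = v.1} ≃ {i // ν i = v.1} :=
      fun ν => (Equiv.subtypeSubtypeEquivSubtype fun {i} (hi : ν i = v.1) => hi ▸ v.2)
    exact ⟨(e μ).trans ((Fintype.equivOfCardEq (hcard v.1 v.2)).trans (e μ').symm)⟩
  let σ := fun v => (hσ v).some
  let f : {i // μ i ≠ 0} → {v : ℕ // v ≠ 0} := fun i => ⟨μ i.1, i.2⟩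
  let f' : {i // μ' i ≠ 0} → {v : ℕ // v ≠ 0} := fun i => ⟨μ' i.1, i.2⟩
  let τ : ∀ v, {i // f i = v} ≃ {i // f' i = v} := fun v =>
    (Equiv.subtypeEquivRight fun i => Subtype.ext_iff).trans
      ((σ v).trans (Equiv.subtypeEquivRight fun i => (Subtype.ext_iff (a1 := f' i)).symm))
  refine ⟨Equiv.ofFiberEquiv τ, fun i => ?_⟩
  exact congrArg Subtype.val (Equiv.ofFiberEquiv_map τ i)

theorem nonempty_jordanModule_equiv {d d' : ℕ} {μ : Fin d → ℕ} {μ' : Fin d' → ℕ}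
    (h : ∀ n, ∑ i, min n (μ i) = ∑ i, min n (μ' i)) :
    Nonempty (JordanModule F μ ≃ₗ[F[X]] JordanModule F μ') := by
  obtain ⟨σ, hσ⟩ := exists_equiv_of_sum_min_eq h
  let e₁ : (JordanModule F fun i : {i // μ i ≠ 0} => μ i.1) ≃ₗ[F[X]]
      JordanModule F fun i : {i // μ i ≠ 0} => μ' (σ i).1 :=
    LinearEquiv.piCongrRight fun i => Submodule.quotEquivOfEq _ _ (by simp only [hσ])
  let e₂ : (JordanModule F fun i : {i // μ i ≠ 0} => μ' (σ i).1) ≃ₗ[F[X]]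
      JordanModule F fun i : {i // μ' i ≠ 0} => μ' i.1 :=
    LinearEquiv.piCongrLeft F[X]
      (fun i : {i // μ' i ≠ 0} => F[X] ⧸ (Ideal.span {(X : F[X]) ^ μ' i.1})) σ
  exact ⟨((jordanModuleNonzeroEquiv μ).trans e₁).trans
    (e₂.trans (jordanModuleNonzeroEquiv μ').symm)⟩

/-- Nilpotent endomorphisms are conjugate if the kernels of their powers have the same
dimensions. -/
theorem exists_conj_eq_of_kernelDims_eq [Finite F] [FiniteDimensional F V] {a b : End F V}
    (ha : IsNilpotent a) (hb : IsNilpotent b) (h : kernelDims a = kernelDims b) :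
    ∃ e : V ≃ₗ[F] V, e.conj a = b := by
  obtain ⟨d, μ, e, he⟩ := exists_jordanModule_equiv ha
  obtain ⟨d', μ', e', he'⟩ := exists_jordanModule_equiv hb
  rw [kernelDims_eq e he, kernelDims_eq e' he'] at h
  obtain ⟨f⟩ := nonempty_jordanModule_equiv (F := F) (congrFun h)
  refine ⟨e.trans ((f.restrictScalars F).trans e'.symm), LinearMap.ext fun v => ?_⟩
  obtain ⟨w, rfl⟩ := (e.trans ((f.restrictScalars F).trans e'.symm)).surjective v
  rw [LinearEquiv.conj_apply_apply, LinearEquiv.symm_apply_apply]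
  apply e'.injective
  rw [he']
  simp [he]

theorem kernelDims_conj (e : V ≃ₗ[F] V) (a : End F V) :
    kernelDims (e.conj a) = kernelDims a := by
  funext n
  have : (e.conj a) ^ n = e.conj (a ^ n) := (map_pow e.conjRingEquiv a n).symm
  rw [kernelDims, kernelDims, this, LinearEquiv.conj_apply, LinearMap.comp_assoc,
    LinearEquiv.ker_comp, LinearMap.ker_comp, ← Submodule.map_equiv_eq_comap_symm,
    LinearEquiv.finrank_map_eq]

/-- The possible kernel dimension sequences of nilpotent endomorphisms of a `k`-dimensional
space. -/
def jordanProfiles (k : ℕ) : Set (ℕ → ℕ) :=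
  {κ | ∃ (d : ℕ) (μ : Fin d → ℕ), ∑ i, μ i = k ∧ κ = fun n => ∑ i, min n (μ i)}

/-- The right-hand side involves only the dimension, not the field; this is what makes the final
coefficients independent of `q`. -/
theorem range_kernelDims [Finite F] [FiniteDimensional F V] :
    Set.range (fun a : {a : End F V // IsNilpotent a} => kernelDims a.1) =
      jordanProfiles (finrank F V) := by
  ext κ
  constructor
  · rintro ⟨⟨a, ha⟩, rfl⟩
    obtain ⟨d, μ, e, he⟩ := exists_jordanModule_equiv ha
    exact ⟨d, μ, by rw [e.finrank_eq, finrank_jordanModule], kernelDims_eq e he⟩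
  · rintro ⟨d, μ, hμ, rfl⟩
    let e : V ≃ₗ[F] JordanModule F μ :=
      LinearEquiv.ofFinrankEq _ _ (by rw [finrank_jordanModule, hμ])
    let a : End F V := e.symm.conj (Algebra.lsmul F F (JordanModule F μ) (X : F[X]))
    have he : ∀ v, e (a v) = (X : F[X]) • e v := fun v => by
      simp [a, LinearEquiv.conj_apply_apply]
    -- The sum of the block sizes bounds each one, so this power of `X` kills every block.
    refine ⟨⟨a, ∑ i, μ i, LinearMap.ext fun v => e.injective ?_⟩, kernelDims_eq e he⟩
    rw [map_pow_eq_X_pow_smul e he, LinearMap.zero_apply, map_zero]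
    funext i
    obtain ⟨g, hg⟩ := Ideal.Quotient.mk_surjective (e v i)
    rw [Pi.smul_apply, ← hg]
    change Ideal.Quotient.mk (Ideal.span {(X : F[X]) ^ μ i}) (X ^ _ * g) = 0
    rw [Ideal.Quotient.eq_zero_iff_mem, Ideal.mem_span_singleton]
    exact (pow_dvd_pow _ (Finset.single_le_sum (fun _ _ => Nat.zero_le _)
      (Finset.mem_univ i))).mul_right g

/-- **Burnside's lemma** for possibly infinite actions. -/
theorem card_fixed_pairs.{u, v} (G : Type u) (X : Type v) [Group G] [MulAction G X] :
    Nat.card {x : G × X // x.1 • x.2 = x.2} =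
      Nat.card (MulAction.orbitRel.Quotient G X) * Nat.card G := by
  rw [← Nat.card_prod, ← Nat.card_congr (MulAction.sigmaFixedByEquivOrbitsProdGroup G X)]
  exact Nat.card_congr (Equiv.subtypeProdEquivSigmaSubtype fun (g : G) (x : X) => g • x = x)

/-- The nilpotent endomorphisms with the conjugation action. -/
def nilpotentEnds (F V : Type*) [Field F] [AddCommGroup V] [Module F V] :
    SubMulAction (ConjAct (End F V)ˣ) (End F V) where
  carrier := {a | IsNilpotent a}
  smul_mem' g a ha := by
    obtain ⟨n, hn⟩ := ha
    exact ⟨n, by rw [← smul_pow', hn, ConjAct.units_smul_def, mul_zero, zero_mul]⟩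

/-- Kernel dimensions form a complete conjugacy invariant, so orbits correspond to attained
profiles. -/
theorem card_nilpotent_orbits [Finite F] [FiniteDimensional F V] :
    Nat.card (MulAction.orbitRel.Quotient (ConjAct (End F V)ˣ) (nilpotentEnds F V)) =
      Nat.card (jordanProfiles (finrank F V)) := by
  rw [← range_kernelDims (F := F) (V := V)]
  refine Nat.card_congr (Equiv.ofBijective (Quotient.lift (fun a : nilpotentEnds F V =>
    (⟨kernelDims a.1, a, rfl⟩ :
      Set.range (fun a : {a : End F V // IsNilpotent a} => kernelDims a.1))) ?_) ⟨?_, ?_⟩)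
  · rintro a b ⟨g, rfl⟩
    exact Subtype.ext (kernelDims_conj (LinearMap.GeneralLinearGroup.toLinearEquiv
      (ConjAct.ofConjAct g)) b.1)
  · intro x y
    induction x, y using Quotient.inductionOn₂ with | _ a b
    intro h
    obtain ⟨e, he⟩ := exists_conj_eq_of_kernelDims_eq b.2 a.2 (congrArg Subtype.val h).symm
    exact Quotient.sound ⟨ConjAct.toConjAct (LinearMap.GeneralLinearGroup.ofLinearEquiv e),
      Subtype.ext he⟩
  · rintro ⟨_, a, rfl⟩
    exact ⟨Quotient.mk _ a, rfl⟩

/-- Burnside for conjugation on nilpotent endomorphisms: being fixed by `g` means commuting with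
`g`. -/
theorem card_unitNilpotentPairs [Finite F] [FiniteDimensional F V] :
    Nat.card (unitNilpotentPairs F V) =
      Nat.card (jordanProfiles (finrank F V)) * glCard F V := by
  have h := card_fixed_pairs (ConjAct (End F V)ˣ) (nilpotentEnds F V)
  have hG : Nat.card (ConjAct (End F V)ˣ) = glCard F V :=
    Nat.card_congr (ConjAct.ofConjAct.toEquiv.trans (Equiv.ofBijective
      (fun u : (End F V)ˣ => (⟨u.1, u.isUnit⟩ : {g : End F V // IsUnit g}))
      ⟨fun u v h => Units.ext (congrArg Subtype.val h), fun g => ⟨g.2.unit, rfl⟩⟩))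
  rw [card_nilpotent_orbits, hG] at h
  rw [← h]
  refine (Nat.card_congr (Equiv.ofBijective
    (fun x : {x : ConjAct (End F V)ˣ × nilpotentEnds F V // x.1 • x.2 = x.2} =>
      (⟨((ConjAct.ofConjAct x.1.1 : (End F V)ˣ), x.1.2.1), Units.isUnit _, x.1.2.2,
        (Units.mul_inv_eq_iff_eq_mul _).1 (congrArg Subtype.val x.2)⟩ :
        unitNilpotentPairs F V)) ⟨?_, ?_⟩)).symm
  · intro x y hxy
    have hxy := congrArg Subtype.val hxy
    exact Subtype.ext (Prod.ext (Units.ext (congrArg Prod.fst hxy))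
      (Subtype.ext (congrArg Prod.snd hxy)))
  · rintro ⟨⟨g, a⟩, hg, ha, hga⟩
    exact ⟨⟨(ConjAct.toConjAct hg.unit, ⟨a, ha⟩),
      Subtype.ext ((Units.mul_inv_eq_iff_eq_mul _).2 hga)⟩, rfl⟩

/-- Base case of the mass recursion: the intertwiner is forced to be zero, leaving only commuting
pairs. -/
theorem intertwiningMass_of_subsingleton [Finite F] {W : Type*} [AddCommGroup W] [Module F W]
    [Subsingleton W] (k : ℕ) (p Y : End F W) :
    intertwiningMass k p Y = Nat.card (jordanProfiles k) := by
  have e : intertwiningTriples (Fin k → F) p Y ≃ unitNilpotentPairs F (Fin k → F) :=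
    { toFun := fun x => ⟨x.1.1, x.2.1⟩
      invFun := fun x => ⟨(x.1, 0), x.2, Subsingleton.elim _ _, Subsingleton.elim _ _⟩
      left_inv := fun x => Subtype.ext (Prod.ext rfl (Subsingleton.elim _ _))
      right_inv := fun _ => rfl }
  have h : (glCard F (Fin k → F) : ℚ) ≠ 0 := by exact_mod_cast glCard_pos.ne'
  rw [intertwiningMass, Nat.card_congr e, card_unitNilpotentPairs, finrank_fin_fun,
    Nat.cast_mul, mul_div_assoc, div_self h, mul_one]

theorem card_jordanProfiles_zero : Nat.card (jordanProfiles 0) = 1 := by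
  have : jordanProfiles 0 = {fun _ => 0} := by
    ext κ
    constructor
    · rintro ⟨d, μ, hμ, rfl⟩
      have : ∀ i, μ i = 0 := fun i => by simpa using Finset.sum_eq_zero_iff.1 hμ i
      simp [this]
    · rintro rfl
      exact ⟨0, Fin.elim0, by simp, by simp⟩
  rw [this, Nat.card_unique]

end NilpotentClasses

/-! ### Parabolic groups and splitting off the first block -/

section Parabolic
variable {F : Type*} [Field F] {s : ℕ}

/-- The invertible matrices in `M^l`. -/
def blockTriangularUnits (F : Type*) [Field F] {s : ℕ} (l : Fin s → ℕ) :
    Set (Matrix (BlockIndex l) (BlockIndex l) F) :=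
  {g | IsUnit g ∧ g ∈ blockTriangularMatrices F l}

/-- Commuting pairs in `P^l × N^l`. -/
def parabolicCommutingPairs (F : Type*) [Field F] {s : ℕ} (l : Fin s → ℕ) :
    Set (Matrix (BlockIndex l) (BlockIndex l) F × Matrix (BlockIndex l) (BlockIndex l) F) :=
  {x | x.1 ∈ blockTriangularUnits F l ∧ x.2 ∈ nilpotentBlockMatrices F l ∧ Commute x.1 x.2}

theorem card_parabolicGroup (l : Fin s → ℕ) :
    Nat.card (parabolicGroup F l) = Nat.card (blockTriangularUnits F l) :=
  Nat.card_congr (Equiv.ofBijective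
    (fun g => (⟨g.1.val, g.1.isUnit, g.2⟩ : blockTriangularUnits F l))
    ⟨fun _ _ H => Subtype.ext (Units.ext (congrArg Subtype.val H)),
      fun g => ⟨⟨g.2.1.unit, g.2.2⟩, rfl⟩⟩)

theorem card_parabolicCommutingPairs (l : Fin s → ℕ) :
    Nat.card (parabolicCommutingPairs F l) = rho F l * Nat.card (blockTriangularUnits F l) := by
  rw [← card_parabolicGroup, rho, orbitCount, ← card_fixed_pairs]
  refine (Nat.card_congr (Equiv.ofBijective
    (fun x : {x : parabolicGroup F l × nilpotentBlockMatrices F l // x.1 • x.2 = x.2} =>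
      (⟨(x.1.1.1.val, x.1.2.1), ⟨x.1.1.1.isUnit, x.1.1.2⟩, x.1.2.2,
        (Units.mul_inv_eq_iff_eq_mul _).1 (congrArg Subtype.val x.2)⟩ :
        parabolicCommutingPairs F l)) ⟨?_, ?_⟩)).symm
  · intro x y hxy
    have hxy := congrArg Subtype.val hxy
    exact Subtype.ext (Prod.ext (Subtype.ext (Units.ext (congrArg Prod.fst hxy)))
      (Subtype.ext (congrArg Prod.snd hxy)))
  · rintro ⟨⟨g, a⟩, ⟨hg, hg'⟩, ha, hga⟩
    exact ⟨⟨(⟨hg.unit, hg'⟩, ⟨a, ha⟩),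
      Subtype.ext ((Units.mul_inv_eq_iff_eq_mul _).2 hga)⟩, rfl⟩

/-- Splitting off the first block of indices. -/
noncomputable def blockIndexConsEquiv (k : ℕ) (l : Fin s → ℕ) :
    Fin k ⊕ BlockIndex l ≃ BlockIndex (Fin.cons k l : Fin (s + 1) → ℕ) :=
  Equiv.ofBijective (Sum.elim (fun a => ⟨0, a⟩) (fun x => ⟨x.1.succ, x.2⟩)) <| by
    constructor
    · rintro (a | ⟨i, a⟩) (b | ⟨j, b⟩) h
      · exact congrArg Sum.inl (sigma_mk_injective (i := (0 : Fin (s + 1))) h)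
      · exact absurd (congrArg Sigma.fst h) (Fin.succ_ne_zero j).symm
      · exact absurd (congrArg Sigma.fst h) (Fin.succ_ne_zero i)
      · obtain rfl : i = j := Fin.succ_injective _ (congrArg Sigma.fst h)
        obtain rfl : a = b := sigma_mk_injective (i := i.succ) h
        rfl
    · rintro ⟨i, a⟩
      induction i using Fin.cases with
      | zero => exact ⟨Sum.inl a, rfl⟩
      | succ i => exact ⟨Sum.inr ⟨i, a⟩, rfl⟩

theorem mem_blockTriangularMatrices_cons_iff {k : ℕ} {l : Fin s → ℕ}
    {h : Matrix (BlockIndex (Fin.cons k l : Fin (s + 1) → ℕ)) (BlockIndex (Fin.cons k l)) F} :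
    h ∈ blockTriangularMatrices F (Fin.cons k l : Fin (s + 1) → ℕ) ↔
      (∀ i a, h (blockIndexConsEquiv k l (Sum.inr i)) (blockIndexConsEquiv k l (Sum.inl a)) = 0) ∧
      Matrix.of (fun i j => h (blockIndexConsEquiv k l (Sum.inr i))
        (blockIndexConsEquiv k l (Sum.inr j))) ∈ blockTriangularMatrices F l := by
  constructor
  · intro H
    refine ⟨fun i a => H (Fin.succ_pos i.1), fun i j hij => H (Fin.succ_lt_succ_iff.2 hij)⟩
  · rintro ⟨H1, H2⟩ i j hij
    obtain ⟨i, rfl⟩ := (blockIndexConsEquiv k l).surjective i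
    obtain ⟨j, rfl⟩ := (blockIndexConsEquiv k l).surjective j
    rcases i with a | i <;> rcases j with b | j
    · exact absurd hij (lt_irrefl _)
    · exact absurd hij (Fin.not_lt_zero _)
    · exact H1 _ _
    · exact H2 (Fin.succ_lt_succ_iff.1 hij)

/-- Coordinates adapted to splitting off the first block. -/
noncomputable def consCoordEquiv (F : Type*) [Field F] (k : ℕ) (l : Fin s → ℕ) :
    (BlockIndex (Fin.cons k l : Fin (s + 1) → ℕ) → F) ≃ₗ[F] (Fin k → F) × (BlockIndex l → F) :=
  (LinearEquiv.funCongrLeft F F (blockIndexConsEquiv k l)).trans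
    (LinearEquiv.sumArrowLequivProdArrow _ _ F F)

/-- Matrices for the block sizes `(k, l)` as endomorphisms of `F^k × F^l`. -/
noncomputable def consMatrixEquiv (F : Type*) [Field F] (k : ℕ) (l : Fin s → ℕ) :
    Matrix (BlockIndex (Fin.cons k l : Fin (s + 1) → ℕ)) (BlockIndex (Fin.cons k l)) F ≃+*
      End F ((Fin k → F) × (BlockIndex l → F)) :=
  (Matrix.toLinAlgEquiv' (R := F)).toRingEquiv.trans (consCoordEquiv F k l).conjRingEquiv

theorem snd_comp_consMatrixEquiv_iff {k : ℕ} {l : Fin s → ℕ}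
    {h : Matrix (BlockIndex (Fin.cons k l : Fin (s + 1) → ℕ)) (BlockIndex (Fin.cons k l)) F}
    {p : Matrix (BlockIndex l) (BlockIndex l) F} :
    LinearMap.snd F (Fin k → F) (BlockIndex l → F) ∘ₗ consMatrixEquiv F k l h =
        Matrix.toLin' p ∘ₗ LinearMap.snd F (Fin k → F) (BlockIndex l → F) ↔
      (∀ i a, h (blockIndexConsEquiv k l (Sum.inr i)) (blockIndexConsEquiv k l (Sum.inl a)) = 0) ∧
      Matrix.of (fun i j => h (blockIndexConsEquiv k l (Sum.inr i))
        (blockIndexConsEquiv k l (Sum.inr j))) = p := by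
  have key : ∀ v i, (consMatrixEquiv F k l h v).2 i =
      ∑ a, h (blockIndexConsEquiv k l (Sum.inr i)) (blockIndexConsEquiv k l (Sum.inl a)) * v.1 a +
      ∑ j, h (blockIndexConsEquiv k l (Sum.inr i)) (blockIndexConsEquiv k l (Sum.inr j)) *
        v.2 j := by
    intro v i
    obtain ⟨w, rfl⟩ := (consCoordEquiv F k l).surjective v
    have h1 : consMatrixEquiv F k l h (consCoordEquiv F k l w) =
        consCoordEquiv F k l (h.mulVec w) := by
      simp [consMatrixEquiv]
    rw [h1]
    change h.mulVec w (blockIndexConsEquiv k l (Sum.inr i)) = _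
    rw [Matrix.mulVec, dotProduct, ← (blockIndexConsEquiv k l).sum_comp, Fintype.sum_sum_type]
    rfl
  constructor
  · intro H
    constructor
    · intro i a
      have := congrFun (LinearMap.congr_fun H (Pi.single a 1, 0)) i
      simpa [key, Pi.single_apply] using this
    · ext i j
      have := congrFun (LinearMap.congr_fun H (0, Pi.single j 1)) i
      simpa [key, Pi.single_apply] using this
  · rintro ⟨H1, rfl⟩
    refine LinearMap.ext fun v => funext fun i => ?_
    change (consMatrixEquiv F k l h v).2 i = _
    rw [key]
    simp [H1, Matrix.mulVec, dotProduct]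

/-- A coordinate-free form of block triangularity: `F^k` is preserved, and the map induced on the
quotient lies in `M^l`. This makes the block counts above applicable. -/
theorem mem_blockTriangularMatrices_cons_iff_exists {k : ℕ} {l : Fin s → ℕ}
    {h : Matrix (BlockIndex (Fin.cons k l : Fin (s + 1) → ℕ)) (BlockIndex (Fin.cons k l)) F} :
    h ∈ blockTriangularMatrices F (Fin.cons k l : Fin (s + 1) → ℕ) ↔
      ∃ p ∈ blockTriangularMatrices F l,
        LinearMap.snd F (Fin k → F) (BlockIndex l → F) ∘ₗ consMatrixEquiv F k l h =
        Matrix.toLin' p ∘ₗ LinearMap.snd F (Fin k → F) (BlockIndex l → F) := by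
  rw [mem_blockTriangularMatrices_cons_iff]
  constructor
  · rintro ⟨h1, h2⟩
    exact ⟨_, h2, snd_comp_consMatrixEquiv_iff.2 ⟨h1, rfl⟩⟩
  · rintro ⟨p, hp, H⟩
    obtain ⟨h1, rfl⟩ := snd_comp_consMatrixEquiv_iff.1 H
    exact ⟨h1, hp⟩

end Parabolic

/-! ### Properties inherited by the quotient -/

section QuotientEndomorphisms
variable {F B J : Type*} [Field F] [AddCommGroup B] [Module F B] [AddCommGroup J] [Module F J]

theorem eq_of_comp_snd_eq {p p' : End F J}
    (h : p ∘ₗ LinearMap.snd F B J = p' ∘ₗ LinearMap.snd F B J) : p = p' :=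
  LinearMap.ext fun j => LinearMap.congr_fun h (0, j)

theorem isUnit_of_snd_comp_eq [FiniteDimensional F J] {h : End F (B × J)} {p : End F J}
    (hh : IsUnit h) (H : LinearMap.snd F B J ∘ₗ h = p ∘ₗ LinearMap.snd F B J) : IsUnit p := by
  rw [LinearMap.isUnit_iff_range_eq_top, LinearMap.range_eq_top]
  intro j
  obtain ⟨x, hx⟩ := ((Module.End.isUnit_iff _).1 hh).surjective (0, j)
  exact ⟨x.2, by simpa [hx] using (LinearMap.congr_fun H x).symm⟩

theorem snd_comp_mul {h h' : End F (B × J)} {p p' : End F J}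
    (H : LinearMap.snd F B J ∘ₗ h = p ∘ₗ LinearMap.snd F B J)
    (H' : LinearMap.snd F B J ∘ₗ h' = p' ∘ₗ LinearMap.snd F B J) :
    LinearMap.snd F B J ∘ₗ (h * h') = (p * p') ∘ₗ LinearMap.snd F B J := by
  rw [Module.End.mul_eq_comp, Module.End.mul_eq_comp, ← LinearMap.comp_assoc, H,
    LinearMap.comp_assoc, H', LinearMap.comp_assoc]

theorem isNilpotent_of_snd_comp_eq {h : End F (B × J)} {p : End F J}
    (hh : IsNilpotent h) (H : LinearMap.snd F B J ∘ₗ h = p ∘ₗ LinearMap.snd F B J) :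
    IsNilpotent p := by
  obtain ⟨n, hn⟩ := hh
  have key : ∀ n : ℕ, LinearMap.snd F B J ∘ₗ (h ^ n) = (p ^ n) ∘ₗ LinearMap.snd F B J := by
    intro n
    induction n with
    | zero => rfl
    | succ n ih => rw [pow_succ, pow_succ]; exact snd_comp_mul ih H
  refine ⟨n, eq_of_comp_snd_eq (F := F) (B := B) ?_⟩
  rw [← key, hn, LinearMap.comp_zero, LinearMap.zero_comp]

end QuotientEndomorphisms

/-! ### Orbit numbers as averages of masses -/

section RhoCons
variable {F : Type*} [Field F] {s : ℕ}

theorem isUnit_toLin'_iff {ι : Type*} [Fintype ι] [DecidableEq ι] {p : Matrix ι ι F} :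
    IsUnit (Matrix.toLin' p) ↔ IsUnit p :=
  MulEquiv.isUnit_map (Matrix.toLinAlgEquiv' (R := F) (n := ι))

theorem isNilpotent_toLin'_iff {ι : Type*} [Fintype ι] [DecidableEq ι] {p : Matrix ι ι F} :
    IsNilpotent (Matrix.toLin' p) ↔ IsNilpotent p :=
  IsNilpotent.map_iff (f := Matrix.toLinAlgEquiv' (R := F) (n := ι))
    Matrix.toLinAlgEquiv'.injective

theorem commute_toLin'_iff {ι : Type*} [Fintype ι] [DecidableEq ι] {p Y : Matrix ι ι F} :
    Commute (Matrix.toLin' p) (Matrix.toLin' Y) ↔ Commute p Y := by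
  rw [commute_iff_eq, commute_iff_eq, Module.End.mul_eq_comp, Module.End.mul_eq_comp,
    ← Matrix.toLin'_mul, ← Matrix.toLin'_mul, Matrix.toLin'.injective.eq_iff]

/-- Elements of `P^(k,l)` in terms of their image in `P^l`. -/
theorem card_blockTriangularUnits_cons [Finite F] (k : ℕ) (l : Fin s → ℕ) :
    Nat.card (blockTriangularUnits F (Fin.cons k l : Fin (s + 1) → ℕ)) =
      Nat.card (blockTriangularUnits F l) *
        (glCard F (Fin k → F) * Nat.card F ^ (k * finrank F (BlockIndex l → F))) := by
  have : Finite (End F ((Fin k → F) × (BlockIndex l → F))) := Module.finite_of_finite F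
  have : Fintype (blockTriangularUnits F l) := Fintype.ofFinite _
  let e : (Σ p : blockTriangularUnits F l, {h : {h : End F ((Fin k → F) × (BlockIndex l → F)) //
      IsUnit h} // LinearMap.snd F _ _ ∘ₗ h.1 = Matrix.toLin' p.1 ∘ₗ LinearMap.snd F _ _}) ≃
      blockTriangularUnits F (Fin.cons k l : Fin (s + 1) → ℕ) :=
    Equiv.ofBijective (fun x => ⟨(consMatrixEquiv F k l).symm x.2.1.1,
      (MulEquiv.isUnit_map (consMatrixEquiv F k l).symm).2 x.2.1.2,
      mem_blockTriangularMatrices_cons_iff_exists.2 ⟨x.1.1, x.1.2.2, by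
        rw [RingEquiv.apply_symm_apply]; exact x.2.2⟩⟩) <| by
      constructor
      · rintro ⟨⟨p, hp⟩, ⟨⟨h, hh⟩, H⟩⟩ ⟨⟨p', hp'⟩, ⟨⟨h', hh'⟩, H'⟩⟩ hx
        obtain rfl : h = h' := (consMatrixEquiv F k l).symm.injective (congrArg Subtype.val hx)
        obtain rfl : p = p' := Matrix.toLin'.injective (eq_of_comp_snd_eq (H.symm.trans H'))
        rfl
      · rintro ⟨h, hh, hM⟩
        obtain ⟨p, hp, H⟩ := mem_blockTriangularMatrices_cons_iff_exists.1 hM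
        have hu := (MulEquiv.isUnit_map (consMatrixEquiv F k l)).2 hh
        exact ⟨⟨⟨p, isUnit_toLin'_iff.1 (isUnit_of_snd_comp_eq hu H), hp⟩,
          ⟨⟨consMatrixEquiv F k l h, hu⟩, H⟩⟩,
          Subtype.ext ((consMatrixEquiv F k l).symm_apply_apply h)⟩
  rw [← Nat.card_congr e, Nat.card_sigma, Finset.sum_congr rfl
    (g := fun _ => glCard F (Fin k → F) * Nat.card F ^ (k * finrank F (BlockIndex l → F))),
    Finset.sum_const, smul_eq_mul, Finset.card_univ, ← Nat.card_eq_fintype_card]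
  rintro p -
  rw [← Nat.card_congr (unitsOverSndEquiv (isUnit_toLin'_iff.2 p.2.1)), Nat.card_prod, glCard]
  congr 1
  rw [natCard_eq_pow_finrank (K := F), finrank_linearMap, mul_comm, finrank_fin_fun]

theorem card_parabolicCommutingPairs_cons [Finite F] (k : ℕ) (l : Fin s → ℕ)
    [Fintype (parabolicCommutingPairs F l)] :
    Nat.card (parabolicCommutingPairs F (Fin.cons k l : Fin (s + 1) → ℕ)) =
      ∑ y : parabolicCommutingPairs F l, Nat.card F ^ (k * finrank F (BlockIndex l → F)) *
        Nat.card (intertwiningTriples (Fin k → F) (Matrix.toLin' y.1.1)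
          (Matrix.toLin' y.1.2)) := by
  have : Finite (End F ((Fin k → F) × (BlockIndex l → F))) := Module.finite_of_finite F
  let e : (Σ y : parabolicCommutingPairs F l, compatiblePairs
      (LinearMap.snd F (Fin k → F) (BlockIndex l → F)) (Matrix.toLin' y.1.1)
        (Matrix.toLin' y.1.2)) ≃
      parabolicCommutingPairs F (Fin.cons k l : Fin (s + 1) → ℕ) :=
    Equiv.ofBijective (fun x => ⟨((consMatrixEquiv F k l).symm x.2.1.1,
      (consMatrixEquiv F k l).symm x.2.1.2),
      ⟨(MulEquiv.isUnit_map (consMatrixEquiv F k l).symm).2 x.2.2.1.1,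
        mem_blockTriangularMatrices_cons_iff_exists.2 ⟨x.1.1.1, x.1.2.1.2, by
          rw [RingEquiv.apply_symm_apply]; exact x.2.2.2.1⟩⟩,
      ⟨mem_blockTriangularMatrices_cons_iff_exists.2 ⟨x.1.1.2, x.1.2.2.1.1, by
          rw [RingEquiv.apply_symm_apply]; exact x.2.2.2.2⟩,
        x.2.2.1.2.1.map (consMatrixEquiv F k l).symm⟩,
      x.2.2.1.2.2.map (consMatrixEquiv F k l).symm⟩) <| by
      constructor
      · rintro ⟨⟨⟨p, Y⟩, hp⟩, ⟨⟨h, a⟩, hh, H1, H2⟩⟩ ⟨⟨⟨p', Y'⟩, hp'⟩, ⟨⟨h', a'⟩, hh', H1', H2'⟩⟩ hx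
        obtain rfl : h = h' := (consMatrixEquiv F k l).symm.injective
          (congrArg (fun z => z.1.1) hx)
        obtain rfl : a = a' := (consMatrixEquiv F k l).symm.injective
          (congrArg (fun z => z.1.2) hx)
        obtain rfl : p = p' := Matrix.toLin'.injective (eq_of_comp_snd_eq (H1.symm.trans H1'))
        obtain rfl : Y = Y' := Matrix.toLin'.injective (eq_of_comp_snd_eq (H2.symm.trans H2'))
        rfl
      · rintro ⟨⟨h, a⟩, ⟨hh, hM⟩, ⟨hM', ha⟩, hc⟩
        obtain ⟨p, hp, H⟩ := mem_blockTriangularMatrices_cons_iff_exists.1 hM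
        obtain ⟨Y, hY, H'⟩ := mem_blockTriangularMatrices_cons_iff_exists.1 hM'
        have hu := (MulEquiv.isUnit_map (consMatrixEquiv F k l)).2 hh
        have hn := ha.map (consMatrixEquiv F k l)
        have hc' := hc.map (consMatrixEquiv F k l)
        -- Commutation descends because the projection is surjective.
        have hpY : Commute p Y := commute_toLin'_iff.1 (eq_of_comp_snd_eq (F := F)
          ((snd_comp_mul H H').symm.trans ((congrArg _ hc'.eq).trans (snd_comp_mul H' H))))
        exact ⟨⟨⟨(p, Y), ⟨isUnit_toLin'_iff.1 (isUnit_of_snd_comp_eq hu H), hp⟩,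
          ⟨hY, isNilpotent_toLin'_iff.1 (isNilpotent_of_snd_comp_eq hn H')⟩, hpY⟩,
          ⟨(consMatrixEquiv F k l h, consMatrixEquiv F k l a), ⟨hu, hn, hc'⟩, H, H'⟩⟩,
          Subtype.ext (Prod.ext ((consMatrixEquiv F k l).symm_apply_apply h)
            ((consMatrixEquiv F k l).symm_apply_apply a))⟩
  rw [← Nat.card_congr e, Nat.card_sigma]
  refine Finset.sum_congr rfl fun y _ => ?_
  rw [card_compatiblePairs_snd (isUnit_toLin'_iff.2 y.2.1.1)
    (isNilpotent_toLin'_iff.2 y.2.2.1.2) (commute_toLin'_iff.2 y.2.2.2), finrank_fin_fun]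

/-- The orbit numbers `ρ_{k,l}` as averages of masses. -/
theorem rho_cons_mul_card [Finite F] (k : ℕ) (l : Fin s → ℕ)
    [Fintype (parabolicCommutingPairs F l)] :
    (rho F (Fin.cons k l : Fin (s + 1) → ℕ) : ℚ) * Nat.card (blockTriangularUnits F l) =
      ∑ y : parabolicCommutingPairs F l,
        intertwiningMass k (Matrix.toLin' y.1.1) (Matrix.toLin' y.1.2) := by
  have h := card_parabolicCommutingPairs (F := F) (Fin.cons k l : Fin (s + 1) → ℕ)
  rw [card_parabolicCommutingPairs_cons, card_blockTriangularUnits_cons, ← Finset.mul_sum] at h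
  have hgl : (glCard F (Fin k → F) : ℚ) ≠ 0 := by exact_mod_cast glCard_pos.ne'
  have hq : ((Nat.card F : ℚ) ^ (k * finrank F (BlockIndex l → F))) ≠ 0 :=
    pow_ne_zero _ (by exact_mod_cast Nat.card_pos.ne')
  simp only [intertwiningMass]
  rw [← Finset.sum_div, eq_div_iff hgl]
  -- The factor `q^(km)` occurs both in the pair count and in the group order.
  refine mul_left_cancel₀ hq ?_
  have h' := congrArg (Nat.cast (R := ℚ)) h
  push_cast at h'
  rw [h']
  ring

end RhoCons

/-! ### Generating functions and the integral recurrence -/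

section Conclusion

/-- The generating function of the numbers of nilpotent conjugacy classes. -/
noncomputable def jordanSeries : PowerSeries ℤ :=
  PowerSeries.mk fun k => (Nat.card (jordanProfiles k) : ℤ)

theorem isUnit_jordanSeries : IsUnit jordanSeries := by
  rw [PowerSeries.isUnit_iff_constantCoeff, ← PowerSeries.coeff_zero_eq_constantCoeff_apply,
    jordanSeries, PowerSeries.coeff_mk, card_jordanProfiles_zero]
  exact isUnit_one

theorem isUnit_prod_one_sub_X_pow (m : ℕ) :
    IsUnit (∏ j ∈ Finset.range m, (1 - PowerSeries.X ^ (j + 1) : PowerSeries ℤ)) := by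
  rw [PowerSeries.isUnit_iff_constantCoeff, map_prod]
  simp

/-- If `R * E` is a polynomial of degree at most `n` for a fixed unit `E`, then the coefficients
of `R` are fixed integral combinations of the first `n + 1` ones. -/
theorem exists_coeff_eq_sum {E G : PowerSeries ℤ} (h : E * G = 1) (n k : ℕ) :
    ∃ a : Fin (n + 1) → ℤ, ∀ R : PowerSeries ℤ,
      (∀ j, n < j → PowerSeries.coeff j (R * E) = 0) →
      PowerSeries.coeff k R = ∑ j, a j * PowerSeries.coeff (j : ℕ) R := by
  -- Write `R = (R E) G` and keep the coefficients of `R E` up to degree `n`. Each of these is a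
  -- combination of the coefficients of `R` of index at most `n`, the terms with `j > i` being zero.
  refine ⟨fun j => ∑ i ∈ Finset.range (n + 1),
    PowerSeries.coeff k (PowerSeries.X ^ i * G) *
      PowerSeries.coeff i (PowerSeries.X ^ (j : ℕ) * E), fun R hR => ?_⟩
  have h1 : ∀ i ∈ Finset.range (n + 1), PowerSeries.coeff i (R * E) =
      ∑ j ∈ Finset.range (n + 1),
        PowerSeries.coeff i (PowerSeries.X ^ j * E) * PowerSeries.coeff j R := by
    intro i hi
    rw [PowerSeries.coeff_mul, Finset.Nat.sum_antidiagonal_eq_sum_range_succ_mk,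
      ← Finset.sum_subset (Finset.range_mono (show i + 1 ≤ n + 1 by simpa using hi))]
    · refine Finset.sum_congr rfl fun j hj => ?_
      rw [PowerSeries.coeff_X_pow_mul', if_pos (by simpa [Nat.lt_succ_iff] using hj), mul_comm]
    · intro j _ hj
      rw [PowerSeries.coeff_X_pow_mul', if_neg (by simpa using hj), zero_mul]
  have h2 : R * E = ∑ i ∈ Finset.range (n + 1),
      PowerSeries.C (PowerSeries.coeff i (R * E)) * PowerSeries.X ^ i := by
    ext j
    simp only [map_sum, PowerSeries.coeff_C_mul, PowerSeries.coeff_X_pow, mul_ite, mul_one,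
      mul_zero, Finset.sum_ite_eq, Finset.mem_range]
    split_ifs with hj
    · rfl
    · exact hR j (by omega)
  have h3 : R = ∑ i ∈ Finset.range (n + 1),
      PowerSeries.C (PowerSeries.coeff i (R * E)) * (PowerSeries.X ^ i * G) := by
    calc R = R * E * G := by rw [mul_assoc, h, mul_one]
      _ = _ := by
        conv_lhs => rw [h2]
        rw [Finset.sum_mul]
        simp only [mul_assoc]
  conv_lhs => rw [h3]
  rw [map_sum, Fin.sum_univ_eq_sum_range (fun j => (∑ i ∈ Finset.range (n + 1),
    PowerSeries.coeff k (PowerSeries.X ^ i * G) *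
      PowerSeries.coeff i (PowerSeries.X ^ j * E)) * PowerSeries.coeff j R)]
  simp only [Finset.sum_mul]
  rw [Finset.sum_comm]
  refine Finset.sum_congr rfl fun i hi => ?_
  rw [PowerSeries.coeff_C_mul, h1 i hi, Finset.sum_mul]
  exact Finset.sum_congr rfl fun j _ => by ring

/-- The generating function of the orbit numbers `ρ_{k,l}`. -/
noncomputable def rhoSeries (F : Type*) [Field F] {s : ℕ} (l : Fin s → ℕ) : PowerSeries ℤ :=
  PowerSeries.mk fun k => (rho F (Fin.cons k l : Fin (s + 1) → ℕ) : ℤ)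

theorem massSeries_of_subsingleton {F W : Type*} [Field F] [Finite F] [AddCommGroup W]
    [Module F W] [Subsingleton W] (p Y : End F W) :
    massSeries p Y = PowerSeries.map (Int.castRingHom ℚ) jordanSeries := by
  ext k
  simp [massSeries, jordanSeries, intertwiningMass_of_subsingleton]

theorem map_rhoSeries_mul {F : Type*} [Field F] [Finite F] {s : ℕ} (l : Fin s → ℕ)
    [Fintype (parabolicCommutingPairs F l)] :
    PowerSeries.map (Int.castRingHom ℚ) (rhoSeries F l) *
        PowerSeries.C (Nat.card (blockTriangularUnits F l) : ℚ) =
      ∑ y : parabolicCommutingPairs F l,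
        massSeries (Matrix.toLin' y.1.1) (Matrix.toLin' y.1.2) := by
  ext k
  rw [PowerSeries.coeff_mul_C, map_sum]
  simpa [rhoSeries, massSeries] using rho_cons_mul_card k l

/-- Up to the nonzero constant `|P^l|`, the orbit series is a sum of mass series. All of them share
the denominator and the factor `C`, which `D` cancels, so a sum of polynomials of bounded degree
remains. -/
theorem coeff_rhoSeries_mul_eq_zero {F : Type*} [Field F] [Finite F] {s m : ℕ} (l : Fin s → ℕ)
    (hl : ∑ i, l i = m) {D : PowerSeries ℤ} (hD : jordanSeries * D = 1) {j : ℕ}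
    (hj : m * (m - 1) / 2 < j) :
    PowerSeries.coeff j (rhoSeries F l *
      ((∏ j ∈ Finset.range m, (1 - PowerSeries.X ^ (j + 1))) * D)) = 0 := by
  have : Fintype (parabolicCommutingPairs F l) := Fintype.ofFinite _
  have hm : finrank F (BlockIndex l → F) = m := by simp [← hl]
  let φ := PowerSeries.map (Int.castRingHom ℚ)
  have hP : (Nat.card (blockTriangularUnits F l) : ℚ) ≠ 0 := by
    have : Nonempty (blockTriangularUnits F l) := ⟨⟨1, isUnit_one, one_mem _⟩⟩
    exact_mod_cast Nat.card_pos.ne'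
  choose Q hQ1 hQ2 using fun y : parabolicCommutingPairs F l =>
    exists_massSeries_mul_eq (F := F) (φ jordanSeries)
      (fun W _ _ _ p Y => massSeries_of_subsingleton p Y) m (BlockIndex l → F)
      (Matrix.toLin' y.1.1) (Matrix.toLin' y.1.2) (isUnit_toLin'_iff.2 y.2.1.1)
      (isNilpotent_toLin'_iff.2 y.2.2.1.2) (commute_toLin'_iff.2 y.2.2.2) hm
  have hprod : φ (∏ j ∈ Finset.range m, (1 - PowerSeries.X ^ (j + 1))) =
      ((∏ j ∈ Finset.range m, (1 - Polynomial.X ^ (j + 1) : Polynomial ℚ) : Polynomial ℚ) :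
        PowerSeries ℚ) := by
    rw [map_prod, ← Polynomial.coeToPowerSeries.ringHom_apply, map_prod]
    exact Finset.prod_congr rfl fun j _ => by simp [φ]
  have key : φ (rhoSeries F l * ((∏ j ∈ Finset.range m, (1 - PowerSeries.X ^ (j + 1))) * D)) *
      PowerSeries.C (Nat.card (blockTriangularUnits F l) : ℚ) =
        ∑ y, (Q y : PowerSeries ℚ) := by
    have hφ : φ jordanSeries * φ D = 1 := by rw [← map_mul, hD, map_one]
    rw [map_mul, map_mul, mul_right_comm, map_rhoSeries_mul, hprod, Finset.sum_mul]
    refine Finset.sum_congr rfl fun y _ => ?_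
    rw [← mul_assoc, hQ2, mul_right_comm, hφ, one_mul]
  have h := congrArg (PowerSeries.coeff j) key
  rw [PowerSeries.coeff_mul_C, map_sum, Finset.sum_eq_zero] at h
  -- Masses are rational, but the orbit series is integral, so the vanishing descends to `ℤ`.
  · have h' := (mul_eq_zero.1 h).resolve_right hP
    rw [PowerSeries.coeff_map] at h'
    exact (map_eq_zero_iff _ Int.cast_injective).1 h'
  · intro y _
    rw [Polynomial.coeff_coe]
    exact Polynomial.coeff_eq_zero_of_natDegree_lt ((hQ1 y).trans_lt hj)

end Conclusion

theorem mainTheorem4 (k m : ℕ) :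
    ∃ a : Fin (m * (m - 1) / 2 + 1) → ℤ,
      ∀ (s : ℕ) (l : Fin s → ℕ), ∑ i, l i = m →
        ∀ (F : Type*) [Field F] [Finite F],
          (rho F (Fin.cons k l : Fin (s + 1) → ℕ) : ℤ) =
            ∑ j : Fin (m * (m - 1) / 2 + 1),
              a j * (rho F (Fin.cons (j : ℕ) l : Fin (s + 1) → ℕ) : ℤ) := by
  obtain ⟨D, hD⟩ := isUnit_jordanSeries.exists_right_inv
  -- The unit and its inverse depend on `m` alone, so `a` is fixed before `l` and `F`.
  obtain ⟨G, hG⟩ := ((isUnit_prod_one_sub_X_pow m).mul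
    (IsUnit.of_mul_eq_one_right _ hD)).exists_right_inv
  obtain ⟨a, ha⟩ := exists_coeff_eq_sum hG (m * (m - 1) / 2) k
  refine ⟨a, fun s l hl F _ _ => ?_⟩
  simpa [rhoSeries] using
    ha (rhoSeries F l) fun j hj => coeff_rhoSeries_mul_eq_zero l hl hD hj
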